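/- Let $\mathbb{X}$ be a category with finite products, with terminal object $\ast$. A \emph{linear assignment} on $\mathbb{X}$ is a finite-product-preserving endofunctor $\mathcal{L}$ of $\mathbb{X}$ together with natural transformations $+_X\colon \mathcal{L}(X)\times\mathcal{L}(X)\to\mathcal{L}(X)$ and $0_X\colon \ast\to\mathcal{L}(X)$ making each $\mathcal{L}(X)$ a commutative monoid, and a natural isomorphism $\nu_X\colon\mathcal{L}\mathcal{L}(X)\to\mathcal{L}(X)$ of monoids such that $\nu_{\mathcal{L}(X)}=\mathcal{L}(\nu_X)$. It is an \emph{additive assignment} if moreover there is a natural $-_X\colon\mathcal{L}(X)\to\mathcal{L}(X)$ making each $\mathcal{L}(X)$ an abelian group. Write $t_X\colon X\to\ast$ for the unique morphism and $\omega_{X,Y}\colon \mathcal{L}(X\times Y)\cong\mathcal{L}(X)\times\mathcal{L}(Y)$ for the canonical isomorphism. A linear (resp. additive) assignment induces a (Rosický) tangent structure $\mathbb{T}_\mathcal{L}$ on $\mathbb{X}$ with tangent bundle functor $\mathcal{T}(X)=X\times\mathcal{L}(X)$, projection $p_X=\pi_1$, sum $1_X\times +_X$, zero $z_X=\langle 1_X,0_X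 t_X\rangle$, vertical lift $\ell_X=(1\times\omega^{-1})\circ(\langle 1_X,0_X t_X\rangle\times\langle 0_X t_{\mathcal{L}(X)},\nu_X^{-1}\rangle)$, canonical flip $c_X=(1\times\omega^{-1})\circ\tau\circ(1\times\omega)$, where $\tau$ interchanges the two middle factors (and negative $1_X\times -_X$). A \emph{differential bundle} over $X$ is an additive bundle $(q\colon E\to X,\sigma\colon E_2\to E,\zeta\colon X\to E)$ (all finite pullback powers $E_n$ of $q$ exist, and $\sigma,\zeta$ form a commutative monoid structure over $X$) with a lift $\lambda\colon E\to\mathcal{T}(E)$ such that: all powers $\mathcal{T}^m$ preserve the pullback powers of $q$; $(\lambda,z_X)\colon E\to \mathcal{T}(E\to X)$ and $(\lambda,\zeta)\colon E\to(p_E\colon\mathcal{T}(E)\to E)$ are additive bundle morphisms; $\mathcal{T}(\lambda)\lambda=\ell_E\lambda$; and the square with sides $\mathcal{T}(\sigma)\langle\lambda\rho_1,z_E\rho_2\rangle\colon E_2\to\mathcal{T}(E)$, $q\rho_1\colon E_2\to X$, $\mathcal{T}(q)$ and $z_X$ is a pullback, preserved by all $\mathcal{T}^m$ (here $\rho_1,\rho_2\colon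 E_2\to E$ are the projections). A \emph{linear bundle morphism} $(f,g)$ from $(E\to X,\lambda)$ to $(E'\to X',\lambda')$ consists of $f\colon E\to E'$, $g\colon X\to X'$ with $q'f=gq$ and $\mathcal{T}(f)\lambda=\lambda' f$; it is a morphism \emph{over $X$} if $X'=X$ and $g=1_X$. Let $\mathsf{DBUN}[(\mathbb{X},\mathbb{T}_\mathcal{L})]$ be the category of differential bundles and linear bundle morphisms, and $\mathsf{DBUN}[(\mathbb{X},\mathbb{T}_\mathcal{L})]_X$ the category of differential bundles over $X$ and linear bundle morphisms over $X$. An \emph{$\mathcal{L}$-algebra} is an object $A$ with an isomorphism $a\colon\mathcal{L}(A)\to A$ such that $\mathcal{L}(a)=\nu_A$; a morphism $(A,a)\to(A',a')$ is an $f\colon A\to A'$ with $a'\mathcal{L}(f)=fa$; $\mathcal{L}\text{-}\mathsf{ALG}$ is the category of these. Transporting the monoid structure of $\mathcal{L}(A)$ along $a$ makes $A$ a commutative monoid with zero $0_a$, and $X\times A$ becomes a differential bundle over $X$ with projection $\pi_1$, fibrewise sum and zero, and lift $(1\times\omega^{-1})\circ(\langle 1_X,0_a t_X\rangle\times\langle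 0_X t_A,a^{-1}\rangle)$. This gives functors $\mathcal{D}\colon\mathbb{X}\times\mathcal{L}\text{-}\mathsf{ALG}\to\mathsf{DBUN}[(\mathbb{X},\mathbb{T}_\mathcal{L})]$, $(X,A)\mapsto X\times A$, $(g,f)\mapsto(g\times f,g)$, and $\mathcal{D}_X\colon\mathcal{L}\text{-}\mathsf{ALG}\to\mathsf{DBUN}[(\mathbb{X},\mathbb{T}_\mathcal{L})]_X$, $A\mapsto X\times A$, $f\mapsto 1_X\times f$. \textbf{Theorem.} Let $\mathbb{X}$ be a category with finite products which has zero morphisms and kernels, and let $\mathcal{L}$ be a linear (resp. additive) assignment on $\mathbb{X}$. Then $\mathcal{D}$ is an equivalence of categories $\mathbb{X}\times\mathcal{L}\text{-}\mathsf{ALG}\simeq\mathsf{DBUN}[(\mathbb{X},\mathbb{T}_\mathcal{L})]$, and, for every object $X$, $\mathcal{D}_X$ is an equivalence of categories $\mathcal{L}\text{-}\mathsf{ALG}\simeq\mathsf{DBUN}[(\mathbb{X},\mathbb{T}_\mathcal{L})]_X$. In particular, every differential bundle over $X$ is isomorphic over $X$, by a linear bundle morphism, to $X\times A$ for some $\mathcal{L}$-algebra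 $A$. -/

import Mathlib

open CategoryTheory Limits MonoidalCategory CartesianMonoidalCategory MonObj
universe v u v' u'
namespace TangentCat
section Bundles
variable {C : Type u} [Category.{v} C] {D : Type u'} [Category.{v'} D]

/-- The diagram of `n` copies of `q : E ⟶ X`. -/
abbrev powerCospan {E X : C} (q : E ⟶ X) (n : ℕ) : WidePullbackShape (Fin n) ⥤ C :=
  WidePullbackShape.wideCospan X (fun _ => E) (fun _ => q)

theorem isLimit_of_existsUnique {E X : C} {q : E ⟶ X} {n : ℕ}
    (c : WidePullbackCone (fun _ : Fin n => q))
    (h : ∀ (Y : C) (x : Y ⟶ X) (y : Fin n → (Y ⟶ E)), (∀ i, y i ≫ q = x) →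
      ∃! k : Y ⟶ c.pt, k ≫ c.base = x ∧ ∀ i, k ≫ c.π i = y i) :
    Nonempty (IsLimit c) := by
  refine ⟨WidePullbackCone.IsLimit.mk c
    (fun t => (h t.pt t.base t.π t.condition).choose) ?_ ?_ ?_⟩
  · intro t
    exact (h t.pt t.base t.π t.condition).choose_spec.1.1
  · intro t i
    exact (h t.pt t.base t.π t.condition).choose_spec.1.2 i
  · intro t m h1 h2
    exact (h t.pt t.base t.π t.condition).choose_spec.2 m ⟨h1, h2⟩

theorem map_existsUnique {E X : C} {q : E ⟶ X} {n : ℕ}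
    {c : WidePullbackCone (fun _ : Fin n => q)} (hc : IsLimit c) (F : C ⥤ D)
    [PreservesLimit (powerCospan q n) F]
    (Y : D) (x : Y ⟶ F.obj X) (y : Fin n → (Y ⟶ F.obj E)) (hy : ∀ i, y i ≫ F.map q = x) :
    ∃! k : Y ⟶ F.obj c.pt, k ≫ F.map c.base = x ∧ ∀ i, k ≫ F.map (c.π i) = y i := by
  have hl := isLimitOfPreserves F hc
  let s : Cone (powerCospan q n ⋙ F) := WidePullbackShape.mkCone x y hy
  refine ⟨hl.lift s, ⟨hl.fac s none, fun i => hl.fac s (some i)⟩, ?_⟩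
  rintro k ⟨h1, h2⟩
  refine hl.uniq s k ?_
  rintro (_ | i)
  · exact h1
  · exact h2 i

theorem preservesLimit_of_existsUnique {E X : C} {q : E ⟶ X} {n : ℕ}
    {c : WidePullbackCone (fun _ : Fin n => q)} (hc : IsLimit c) (F : C ⥤ D)
    (h : ∀ (Y : D) (x : Y ⟶ F.obj X) (y : Fin n → (Y ⟶ F.obj E)), (∀ i, y i ≫ F.map q = x) →
      ∃! k : Y ⟶ F.obj c.pt, k ≫ F.map c.base = x ∧ ∀ i, k ≫ F.map (c.π i) = y i) :
    PreservesLimit (powerCospan q n) F := by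
  have key : ∀ s : Cone (powerCospan q n ⋙ F), ∀ i : Fin n,
      s.π.app (some i) ≫ F.map q = s.π.app none := fun s i => by
    exact s.w (WidePullbackShape.Hom.term i)
  refine preservesLimit_of_preserves_limit_cone hc
    { lift := fun s => (h s.pt (s.π.app none) (fun i => s.π.app (some i)) (key s)).choose
      fac := ?_
      uniq := ?_ }
  · rintro s (_ | i)
    · exact (h s.pt (s.π.app none) (fun i => s.π.app (some i)) (key s)).choose_spec.1.1
    · exact (h s.pt (s.π.app none) (fun i => s.π.app (some i)) (key s)).choose_spec.1.2 i
  · intro s m hm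
    exact (h s.pt (s.π.app none) (fun i => s.π.app (some i)) (key s)).choose_spec.2 m
      ⟨hm none, fun i => hm (some i)⟩

/-- The laws of an additive bundle `(q : E ⟶ X, σ, ζ)`: all finite pullback powers of `q` exist,
`E₂` with projections `ρ₁, ρ₂` is the pullback of two copies of `q`, and `(σ, ζ)` is a fibrewise
commutative monoid structure. The associativity diagram is stated on generalized elements of the
pullback of three copies of `q`; `isPullback.lift a b _` is the pairing `⟨a, b⟩`. -/
structure IsAdditiveBundle {X E E₂ : C} (q : E ⟶ X) (ρ₁ ρ₂ : E₂ ⟶ E) (σ : E₂ ⟶ E)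
    (ζ : X ⟶ E) : Prop where
  hasPowers : ∀ n : ℕ, HasWidePullback X (fun _ : Fin n => E) (fun _ => q)
  isPullback : IsPullback ρ₁ ρ₂ q q
  add_proj : σ ≫ q = ρ₁ ≫ q
  zero_proj : ζ ≫ q = 𝟙 X
  add_assoc : ∀ {Y : C} (a b c : Y ⟶ E) (hab : a ≫ q = b ≫ q) (hbc : b ≫ q = c ≫ q),
    isPullback.lift (isPullback.lift a b hab ≫ σ) c (by simp [add_proj, hab, hbc]) ≫ σ =
      isPullback.lift a (isPullback.lift b c hbc ≫ σ) (by simp [add_proj, hab]) ≫ σ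
  zero_add : isPullback.lift (q ≫ ζ) (𝟙 E) (by simp [zero_proj]) ≫ σ = 𝟙 E
  add_zero : isPullback.lift (𝟙 E) (q ≫ ζ) (by simp [zero_proj]) ≫ σ = 𝟙 E
  add_comm : isPullback.lift ρ₂ ρ₁ isPullback.w.symm ≫ σ = σ

/-- An additive bundle over `X`, with a chosen pullback `pair` of two copies of its projection. -/
structure AdditiveBundle (X : C) where
  total : C
  proj : total ⟶ X
  pair : C
  fst : pair ⟶ total
  snd : pair ⟶ total
  add : pair ⟶ total
  zero : X ⟶ total
  isAdditive : IsAdditiveBundle proj fst snd add zero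

namespace AdditiveBundle

section
variable {X : C} (B : AdditiveBundle X)

/-- The pairing `⟨a, b⟩` into the pullback of two copies of the projection. -/
noncomputable def pairing {Y : C} (a b : Y ⟶ B.total)
    (h : a ≫ B.proj = b ≫ B.proj) : Y ⟶ B.pair := B.isAdditive.isPullback.lift a b h

@[simp]
theorem pairing_fst {Y : C} (a b : Y ⟶ B.total) (h : a ≫ B.proj = b ≫ B.proj) :
    B.pairing a b h ≫ B.fst = a := B.isAdditive.isPullback.lift_fst _ _ _

@[simp]
theorem pairing_snd {Y : C} (a b : Y ⟶ B.total) (h : a ≫ B.proj = b ≫ B.proj) :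
    B.pairing a b h ≫ B.snd = b := B.isAdditive.isPullback.lift_snd _ _ _

theorem pair_hom_ext {Y : C} {k l : Y ⟶ B.pair} (h₁ : k ≫ B.fst = l ≫ B.fst)
    (h₂ : k ≫ B.snd = l ≫ B.snd) : k = l := B.isAdditive.isPullback.hom_ext h₁ h₂

theorem isPullback_map (F : C ⥤ D) [∀ n, PreservesLimit (powerCospan B.proj n) F] :
    IsPullback (F.map B.fst) (F.map B.snd) (F.map B.proj) (F.map B.proj) := by
  let c : WidePullbackCone (fun _ : Fin 2 => B.proj) :=
    WidePullbackCone.mk (B.fst ≫ B.proj) ![B.fst, B.snd] (by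
      intro i; fin_cases i
      · rfl
      · exact B.isAdditive.isPullback.w.symm)
  have hc : Nonempty (IsLimit c) := by
    refine isLimit_of_existsUnique c fun Y x y hy => ?_
    refine ⟨B.pairing (y 0) (y 1) ((hy 0).trans (hy 1).symm), ⟨?_, ?_⟩, ?_⟩
    · change _ ≫ B.fst ≫ B.proj = x
      rw [← Category.assoc, pairing_fst]; exact hy 0
    · intro i; fin_cases i
      · exact B.pairing_fst _ _ _
      · exact B.pairing_snd _ _ _
    · rintro k ⟨-, h⟩
      exact B.pair_hom_ext ((h 0).trans (B.pairing_fst _ _ _).symm)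
        ((h 1).trans (B.pairing_snd _ _ _).symm)
  obtain ⟨hc⟩ := hc
  refine ⟨⟨by rw [← F.map_comp, ← F.map_comp, B.isAdditive.isPullback.w]⟩, ⟨?_⟩⟩
  have key := fun s : PullbackCone (F.map B.proj) (F.map B.proj) =>
    map_existsUnique hc F s.pt (s.fst ≫ F.map B.proj) ![s.fst, s.snd] (by
      intro i; fin_cases i
      · rfl
      · exact s.condition.symm)
  refine PullbackCone.IsLimit.mk _ (fun s => (key s).choose) ?_ ?_ ?_
  · exact fun s => (key s).choose_spec.1.2 0
  · exact fun s => (key s).choose_spec.1.2 1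
  · intro s m h₁ h₂
    refine (key s).choose_spec.2 m ⟨?_, ?_⟩
    · change m ≫ F.map (B.fst ≫ B.proj) = _
      rw [F.map_comp, ← Category.assoc, h₁]
    · intro i; fin_cases i
      · exact h₁
      · exact h₂

theorem isAdditive_map (F : C ⥤ D) [∀ n, PreservesLimit (powerCospan B.proj n) F] :
    IsAdditiveBundle (F.map B.proj) (F.map B.fst) (F.map B.snd) (F.map B.add)
      (F.map B.zero) where
  hasPowers n := by
    obtain ⟨⟨c, hc⟩⟩ := (B.isAdditive.hasPowers n).exists_limit
    obtain ⟨h⟩ := isLimit_of_existsUnique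
      (WidePullbackCone.mk (f := fun _ : Fin n => F.map B.proj)
        (F.map (WidePullbackCone.base c)) (fun i => F.map (WidePullbackCone.π c i))
        (fun i => by rw [← F.map_comp, WidePullbackCone.condition]))
      (map_existsUnique hc F)
    exact ⟨⟨⟨_, h⟩⟩⟩
  isPullback := B.isPullback_map F
  add_proj := by rw [← F.map_comp, ← F.map_comp, B.isAdditive.add_proj]
  zero_proj := by rw [← F.map_comp, B.isAdditive.zero_proj, F.map_id]
  add_assoc := by
    intro Y a b c hab hbc
    obtain ⟨⟨s, hs⟩⟩ := (B.isAdditive.hasPowers 3).exists_limit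
    obtain ⟨k, ⟨-, hk⟩, -⟩ := map_existsUnique hs F Y (a ≫ F.map B.proj) ![a, b, c] (by
      intro i; fin_cases i
      · rfl
      · exact hab.symm
      · exact (hab.trans hbc).symm)
    obtain rfl : k ≫ F.map (WidePullbackCone.π s 0) = a := hk 0
    obtain rfl : k ≫ F.map (WidePullbackCone.π s 1) = b := hk 1
    obtain rfl : k ≫ F.map (WidePullbackCone.π s 2) = c := hk 2
    have h01 : WidePullbackCone.π s 0 ≫ B.proj = WidePullbackCone.π s 1 ≫ B.proj :=
      (WidePullbackCone.condition s 0).trans (WidePullbackCone.condition s 1).symm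
    have h12 : WidePullbackCone.π s 1 ≫ B.proj = WidePullbackCone.π s 2 ≫ B.proj :=
      (WidePullbackCone.condition s 1).trans (WidePullbackCone.condition s 2).symm
    have key : ∀ {Z : C} (g : Y ⟶ F.obj Z) (u v : Z ⟶ B.total) (h : u ≫ B.proj = v ≫ B.proj)
        (h' : (g ≫ F.map u) ≫ F.map B.proj = (g ≫ F.map v) ≫ F.map B.proj),
        (B.isPullback_map F).lift (g ≫ F.map u) (g ≫ F.map v) h' ≫ F.map B.add =
          g ≫ F.map (B.isAdditive.isPullback.lift u v h ≫ B.add) := by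
      intro Z g u v h h'
      rw [F.map_comp, ← Category.assoc]
      congr 1
      apply (B.isPullback_map F).hom_ext
      · rw [IsPullback.lift_fst, Category.assoc, ← F.map_comp, IsPullback.lift_fst]
      · rw [IsPullback.lift_snd, Category.assoc, ← F.map_comp, IsPullback.lift_snd]
    simp only [key k _ _ h01, key k _ _ h12]
    rw [key k _ _ (by simp [B.isAdditive.add_proj, h01, h12]), key k _ _ (by simp [B.isAdditive.add_proj, h01]),
      B.isAdditive.add_assoc _ _ _ h01 h12]
  zero_add := by
    refine Eq.trans ?_ ((congrArg F.map B.isAdditive.zero_add).trans (F.map_id _))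
    refine Eq.trans ?_ (F.map_comp _ _).symm
    congr 1
    apply (B.isPullback_map F).hom_ext
    · rw [IsPullback.lift_fst, ← F.map_comp, ← F.map_comp, IsPullback.lift_fst]
    · rw [IsPullback.lift_snd, ← F.map_comp, IsPullback.lift_snd, F.map_id]
  add_zero := by
    refine Eq.trans ?_ ((congrArg F.map B.isAdditive.add_zero).trans (F.map_id _))
    refine Eq.trans ?_ (F.map_comp _ _).symm
    congr 1
    apply (B.isPullback_map F).hom_ext
    · rw [IsPullback.lift_fst, ← F.map_comp, IsPullback.lift_fst, F.map_id]
    · rw [IsPullback.lift_snd, ← F.map_comp, ← F.map_comp, IsPullback.lift_snd]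
  add_comm := by
    conv_rhs => rw [← B.isAdditive.add_comm, F.map_comp]
    congr 1
    apply (B.isPullback_map F).hom_ext
    · rw [IsPullback.lift_fst, ← F.map_comp, IsPullback.lift_fst]
    · rw [IsPullback.lift_snd, ← F.map_comp, IsPullback.lift_snd]

/-- The image of an additive bundle under a functor preserving the pullback powers of its
projection. -/
def map (F : C ⥤ D) (hF : ∀ n, PreservesLimit (powerCospan B.proj n) F) :
    AdditiveBundle (F.obj X) where
  total := F.obj B.total
  proj := F.map B.proj
  pair := F.obj B.pair
  fst := F.map B.fst
  snd := F.map B.snd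
  add := F.map B.add
  zero := F.map B.zero
  isAdditive := B.isAdditive_map F

end

/-- `(f, g)` is an additive bundle morphism: a commutative square which preserves the sum and
the zero. -/
structure IsHom {X X' : C} (B : AdditiveBundle X) (B' : AdditiveBundle X')
    (f : B.total ⟶ B'.total) (g : X ⟶ X') : Prop where
  comm : f ≫ B'.proj = B.proj ≫ g
  map_add : B.add ≫ f = B'.pairing (B.fst ≫ f) (B.snd ≫ f)
    (by rw [Category.assoc, Category.assoc, comm, ← Category.assoc, B.isAdditive.isPullback.w,
      Category.assoc]) ≫ B'.add
  map_zero : B.zero ≫ f = g ≫ B'.zero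

theorem IsHom.of_pair {X X' : C} {B : AdditiveBundle X} {B' : AdditiveBundle X'}
    {f : B.total ⟶ B'.total} {g : X ⟶ X'} (comm : f ≫ B'.proj = B.proj ≫ g)
    (k : B.pair ⟶ B'.pair) (hk₁ : k ≫ B'.fst = B.fst ≫ f) (hk₂ : k ≫ B'.snd = B.snd ≫ f)
    (map_add : B.add ≫ f = k ≫ B'.add) (map_zero : B.zero ≫ f = g ≫ B'.zero) :
    B.IsHom B' f g where
  comm := comm
  map_add := by
    rw [map_add]
    congr 1
    apply B'.pair_hom_ext
    · rw [hk₁, B'.pairing_fst]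
    · rw [hk₂, B'.pairing_snd]
  map_zero := map_zero

end AdditiveBundle

/-- The powers `F ^ m` of an endofunctor. -/
def iter (F : C ⥤ C) : ℕ → (C ⥤ C)
  | 0 => 𝟭 C
  | m + 1 => iter F m ⋙ F

end Bundles

section Tangent

/-- The additive part of a tangent structure: the tangent bundle functor `T`, the projection `p`,
the functor `T₂` of pullbacks of two copies of `p` with its projections `fst` and `snd`, the sum
`s` and the zero `z`. -/
structure AdditiveTangentFunctor (C : Type u) [Category.{v} C] where
  T : C ⥤ C
  T₂ : C ⥤ C
  p (X : C) : T.obj X ⟶ X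
  fst (X : C) : T₂.obj X ⟶ T.obj X
  snd (X : C) : T₂.obj X ⟶ T.obj X
  s (X : C) : T₂.obj X ⟶ T.obj X
  z (X : C) : X ⟶ T.obj X
  p_naturality {X Y : C} (f : X ⟶ Y) : T.map f ≫ p Y = p X ≫ f
  fst_naturality {X Y : C} (f : X ⟶ Y) : T₂.map f ≫ fst Y = fst X ≫ T.map f
  snd_naturality {X Y : C} (f : X ⟶ Y) : T₂.map f ≫ snd Y = snd X ≫ T.map f
  s_naturality {X Y : C} (f : X ⟶ Y) : T₂.map f ≫ s Y = s X ≫ T.map f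
  z_naturality {X Y : C} (f : X ⟶ Y) : f ≫ z Y = z X ≫ T.map f
  isAdditive (X : C) : IsAdditiveBundle (p X) (fst X) (snd X) (s X) (z X)
  preserves (X : C) (n m : ℕ) : PreservesLimit (powerCospan (p X) n) (iter T m)

namespace AdditiveTangentFunctor

variable {C : Type u} [Category.{v} C] (S : AdditiveTangentFunctor C)

/-- The tangent bundle `T(X)` as an additive bundle over `X`. -/
def bundle (X : C) : AdditiveBundle X where
  total := S.T.obj X
  proj := S.p X
  pair := S.T₂.obj X
  fst := S.fst X
  snd := S.snd X
  add := S.s X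
  zero := S.z X
  isAdditive := S.isAdditive X

/-- The image under `T` of an additive bundle whose pullback powers are preserved by all powers
of `T`. -/
def mapBundle {X : C} (B : AdditiveBundle X)
    (h : ∀ n m, PreservesLimit (powerCospan B.proj n) (iter S.T m)) :
    AdditiveBundle (S.T.obj X) :=
  B.map S.T (fun n => h n 1)

end AdditiveTangentFunctor

/-- A tangent structure on a category `C`, with vertical lift `ℓ` and canonical flip `c`. -/
structure TangentStructure (C : Type u) [Category.{v} C] extends AdditiveTangentFunctor C where
  ℓ (X : C) : T.obj X ⟶ T.obj (T.obj X)
  ℓ_naturality {X Y : C} (f : X ⟶ Y) : T.map f ≫ ℓ Y = ℓ X ≫ T.map (T.map f)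
  ℓ_isHom (X : C) : (toAdditiveTangentFunctor.bundle X).IsHom
    (toAdditiveTangentFunctor.mapBundle (toAdditiveTangentFunctor.bundle X) (preserves X))
    (ℓ X) (z X)
  ℓ_ℓ (X : C) : ℓ X ≫ ℓ (T.obj X) = ℓ X ≫ T.map (ℓ X)
  ℓ_universal (X : C) : IsPullback
    ((toAdditiveTangentFunctor.mapBundle (toAdditiveTangentFunctor.bundle X)
      (preserves X)).pairing (fst X ≫ ℓ X) (snd X ≫ z (T.obj X)) (by
        have h₁ : ℓ X ≫ T.map (p X) = p X ≫ z X := (ℓ_isHom X).comm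
        have h₂ : fst X ≫ p X = snd X ≫ p X := (isAdditive X).isPullback.w
        change (fst X ≫ ℓ X) ≫ T.map (p X) = (snd X ≫ z (T.obj X)) ≫ T.map (p X)
        rw [Category.assoc, Category.assoc, h₁, ← z_naturality, ← Category.assoc, h₂,
          Category.assoc]) ≫ T.map (s X))
    (fst X ≫ p X) (T.map (p X)) (z X)
  c (X : C) : T.obj (T.obj X) ⟶ T.obj (T.obj X)
  c_naturality {X Y : C} (f : X ⟶ Y) : T.map (T.map f) ≫ c Y = c X ≫ T.map (T.map f)
  c_c (X : C) : c X ≫ c X = 𝟙 (T.obj (T.obj X))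
  c_yangBaxter (X : C) : T.map (c X) ≫ c (T.obj X) ≫ T.map (c X) =
    c (T.obj X) ≫ T.map (c X) ≫ c (T.obj X)
  c_isHom (X : C) :
    (toAdditiveTangentFunctor.mapBundle (toAdditiveTangentFunctor.bundle X) (preserves X)).IsHom
      (toAdditiveTangentFunctor.bundle (T.obj X)) (c X) (𝟙 (T.obj X))
  ℓ_c (X : C) : ℓ X ≫ c X = ℓ X
  ℓ_T_c (X : C) : ℓ (T.obj X) ≫ T.map (c X) ≫ c (T.obj X) = c X ≫ T.map (ℓ X)

/-- A Rosický tangent structure: a tangent structure with a natural negative `n` making every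
tangent bundle an abelian group bundle. -/
structure RosickyTangentStructure (C : Type u) [Category.{v} C] extends TangentStructure C where
  n (X : C) : T.obj X ⟶ T.obj X
  n_naturality {X Y : C} (f : X ⟶ Y) : T.map f ≫ n Y = n X ≫ T.map f
  n_p (X : C) : n X ≫ p X = p X
  add_n (X : C) : (isAdditive X).isPullback.lift (𝟙 (T.obj X)) (n X) (by simp [n_p]) ≫ s X =
    p X ≫ z X
  n_add (X : C) : (isAdditive X).isPullback.lift (n X) (𝟙 (T.obj X)) (by simp [n_p]) ≫ s X =
    p X ≫ z X

variable {C : Type u} [Category.{v} C]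

/-- A differential bundle over `X` in the tangent category `(C, 𝕋)`. -/
structure DifferentialBundle (𝕋 : TangentStructure C) (X : C) extends AdditiveBundle X where
  preserves (n m : ℕ) : PreservesLimit (powerCospan proj n) (iter 𝕋.T m)
  lift : total ⟶ 𝕋.T.obj total
  lift_isHom_map : toAdditiveBundle.IsHom (𝕋.mapBundle toAdditiveBundle preserves) lift (𝕋.z X)
  lift_isHom_tangent : toAdditiveBundle.IsHom (𝕋.bundle total) lift zero
  lift_lift : lift ≫ 𝕋.T.map lift = lift ≫ 𝕋.ℓ total
  lift_universal (m : ℕ) : IsPullback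
    ((iter 𝕋.T m).map ((𝕋.mapBundle toAdditiveBundle preserves).pairing
      (fst ≫ lift) (snd ≫ 𝕋.z total) (by
        have h₁ : lift ≫ 𝕋.T.map proj = proj ≫ 𝕋.z X := lift_isHom_map.comm
        have h₂ : fst ≫ proj = snd ≫ proj := isAdditive.isPullback.w
        change (fst ≫ lift) ≫ 𝕋.T.map proj = (snd ≫ 𝕋.z total) ≫ 𝕋.T.map proj
        rw [Category.assoc, Category.assoc, h₁, ← 𝕋.z_naturality, ← Category.assoc, h₂,
          Category.assoc]) ≫ 𝕋.T.map add))
    ((iter 𝕋.T m).map (fst ≫ proj)) ((iter 𝕋.T m).map (𝕋.T.map proj)) ((iter 𝕋.T m).map (𝕋.z X))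

/-- Linear bundle morphisms over a fixed base `X`. -/
@[ext]
structure LinearMorphismOver {𝕋 : TangentStructure C} {X : C} (B B' : DifferentialBundle 𝕋 X) where
  hom : B.total ⟶ B'.total
  comm : hom ≫ B'.proj = B.proj
  lift : B.lift ≫ 𝕋.T.map hom = hom ≫ B'.lift

/-- The category of differential bundles over `X` and linear bundle morphisms over `X`. -/
instance (𝕋 : TangentStructure C) (X : C) : Category (DifferentialBundle 𝕋 X) where
  Hom := LinearMorphismOver
  id B := ⟨𝟙 _, by simp, by simp⟩
  comp f g := ⟨f.hom ≫ g.hom, by simp [f.comm, g.comm], by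
    rw [Functor.map_comp, ← Category.assoc, f.lift, Category.assoc, g.lift, Category.assoc]⟩
  id_comp f := LinearMorphismOver.ext (Category.id_comp _)
  comp_id f := LinearMorphismOver.ext (Category.comp_id _)
  assoc f g h := LinearMorphismOver.ext (Category.assoc _ _ _)

/-- The differential bundles of the tangent category `(C, 𝕋)`, over arbitrary bases. -/
structure DBun (𝕋 : TangentStructure C) where
  base : C
  bundle : DifferentialBundle 𝕋 base

/-- Linear bundle morphisms. -/
@[ext]
structure LinearMorphism {𝕋 : TangentStructure C} (B B' : DBun 𝕋) where
  total : B.bundle.total ⟶ B'.bundle.total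
  base : B.base ⟶ B'.base
  comm : total ≫ B'.bundle.proj = B.bundle.proj ≫ base
  lift : B.bundle.lift ≫ 𝕋.T.map total = total ≫ B'.bundle.lift

/-- The category of differential bundles and linear bundle morphisms. -/
instance (𝕋 : TangentStructure C) : Category (DBun 𝕋) where
  Hom := LinearMorphism
  id B := ⟨𝟙 _, 𝟙 _, by simp, by simp⟩
  comp f g := ⟨f.total ≫ g.total, f.base ≫ g.base, by
      rw [Category.assoc, g.comm, ← Category.assoc, f.comm, Category.assoc], by
    rw [Functor.map_comp, ← Category.assoc, f.lift, Category.assoc, g.lift, Category.assoc]⟩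
  id_comp f := LinearMorphism.ext (Category.id_comp _) (Category.id_comp _)
  comp_id f := LinearMorphism.ext (Category.comp_id _) (Category.comp_id _)
  assoc f g h := LinearMorphism.ext (Category.assoc _ _ _) (Category.assoc _ _ _)

end Tangent

section Products

variable {C : Type u} [Category.{v} C] [CartesianMonoidalCategory C]
  {D : Type u'} [Category.{v'} D] [CartesianMonoidalCategory D]

theorem map_prod_hom_ext (F : C ⥤ D) [PreservesFiniteProducts F] {X Z : C} {Y : D}
    {f g : Y ⟶ F.obj (X ⊗ Z)} (h₁ : f ≫ F.map (fst X Z) = g ≫ F.map (fst X Z))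
    (h₂ : f ≫ F.map (snd X Z) = g ≫ F.map (snd X Z)) : f = g := by
  rw [← cancel_mono (CartesianMonoidalCategory.prodComparison F X Z)]
  apply CartesianMonoidalCategory.hom_ext <;> simpa

/-- The morphism into `F (X ⊗ Z) ≅ F X ⊗ F Z` with given components. -/
noncomputable def mapLift (F : C ⥤ D) [PreservesFiniteProducts F] {X Z : C} {Y : D}
    (a : Y ⟶ F.obj X) (b : Y ⟶ F.obj Z) : Y ⟶ F.obj (X ⊗ Z) :=
  lift a b ≫ inv (CartesianMonoidalCategory.prodComparison F X Z)

@[simp]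
theorem mapLift_fst (F : C ⥤ D) [PreservesFiniteProducts F] {X Z : C} {Y : D}
    (a : Y ⟶ F.obj X) (b : Y ⟶ F.obj Z) : mapLift F a b ≫ F.map (fst X Z) = a := by
  simp [mapLift]

@[simp]
theorem mapLift_snd (F : C ⥤ D) [PreservesFiniteProducts F] {X Z : C} {Y : D}
    (a : Y ⟶ F.obj X) (b : Y ⟶ F.obj Z) : mapLift F a b ≫ F.map (snd X Z) = b := by
  simp [mapLift]

@[simp]
theorem mapLift_fst_comp (F : C ⥤ D)
    [PreservesFiniteProducts F] {X Z : C} {Y W : D} (a : Y ⟶ F.obj X) (b : Y ⟶ F.obj Z)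
    (h : F.obj X ⟶ W) : mapLift F a b ≫ F.map (fst X Z) ≫ h = a ≫ h := by
  rw [← Category.assoc, mapLift_fst]

@[simp]
theorem mapLift_snd_comp (F : C ⥤ D)
    [PreservesFiniteProducts F] {X Z : C} {Y W : D} (a : Y ⟶ F.obj X) (b : Y ⟶ F.obj Z)
    (h : F.obj Z ⟶ W) : mapLift F a b ≫ F.map (snd X Z) ≫ h = b ≫ h := by
  rw [← Category.assoc, mapLift_snd]

theorem comp_mapLift (F : C ⥤ D) [PreservesFiniteProducts F] {X Z : C} {Y W : D} (k : W ⟶ Y)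
    (a : Y ⟶ F.obj X) (b : Y ⟶ F.obj Z) : k ≫ mapLift F a b = mapLift F (k ≫ a) (k ≫ b) := by
  apply map_prod_hom_ext F <;> simp

/-- `X ⊗ M ^ n` as a cone over `n` copies of the projection `X ⊗ M ⟶ X`. -/
noncomputable def powerCone (X M : C) (n : ℕ) : WidePullbackCone (fun _ : Fin n => fst X M) :=
  WidePullbackCone.mk (W := X ⊗ ∏ᶜ fun _ : Fin n => M) (fst _ _)
    (fun i => X ◁ Pi.π (fun _ : Fin n => M) i) (by simp)

theorem powerCone_existsUnique (F : C ⥤ D) [PreservesFiniteProducts F] (X M : C) (n : ℕ)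
    (Y : D) (x : Y ⟶ F.obj X) (y : Fin n → (Y ⟶ F.obj (X ⊗ M)))
    (hy : ∀ i, y i ≫ F.map (fst X M) = x) :
    ∃! k : Y ⟶ F.obj (powerCone X M n).pt,
      k ≫ F.map (powerCone X M n).base = x ∧ ∀ i, k ≫ F.map ((powerCone X M n).π i) = y i := by
  change ∃! k : Y ⟶ F.obj (X ⊗ ∏ᶜ fun _ : Fin n => M), k ≫ F.map (fst _ _) = x ∧
    ∀ i, k ≫ F.map (X ◁ Pi.π (fun _ : Fin n => M) i) = y i
  have hP := isLimitFanMkObjOfIsLimit F _ _ (productIsProduct (fun _ : Fin n => M))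
  refine ⟨mapLift F x (Fan.IsLimit.lift hP (fun i => y i ≫ F.map (snd _ _))), ⟨by simp, ?_⟩, ?_⟩
  · intro i
    apply map_prod_hom_ext F
    · rw [Category.assoc, ← F.map_comp, whiskerLeft_fst, mapLift_fst, hy]
    · rw [Category.assoc, ← F.map_comp, whiskerLeft_snd, F.map_comp, ← Category.assoc,
        mapLift_snd]
      exact Fan.IsLimit.fac hP _ i
  · rintro k ⟨h₁, h₂⟩
    apply map_prod_hom_ext F
    · rw [h₁, mapLift_fst]
    · rw [mapLift_snd]
      refine Fan.IsLimit.hom_ext hP _ _ fun i => ?_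
      refine Eq.trans ?_ (Fan.IsLimit.fac hP _ i).symm
      change (k ≫ F.map (snd _ _)) ≫ F.map (Pi.π (fun _ : Fin n => M) i) = _
      rw [← h₂, Category.assoc, Category.assoc, ← F.map_comp, ← F.map_comp, whiskerLeft_snd]

theorem powerCone_isLimit (X M : C) (n : ℕ) : Nonempty (IsLimit (powerCone X M n)) :=
  isLimit_of_existsUnique _ (powerCone_existsUnique (𝟭 C) X M n)

theorem preserves_powers (F : C ⥤ D) [PreservesFiniteProducts F] (X M : C) (n : ℕ) :
    PreservesLimit (powerCospan (fst X M) n) F :=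
  preservesLimit_of_existsUnique (powerCone_isLimit X M n).some F (powerCone_existsUnique F X M n)

theorem iter_preservesFiniteProducts (F : C ⥤ C) [PreservesFiniteProducts F] (m : ℕ) :
    PreservesFiniteProducts (iter F m) := by
  induction m with
  | zero => exact inferInstanceAs (PreservesFiniteProducts (𝟭 C))
  | succ m ih => exact inferInstanceAs (PreservesFiniteProducts (iter F m ⋙ F))

/-- The image under `F` of the pullback of `f ⊗ Z` along the section of `X ⊗ Z ⟶ X` given by a
point of `Z` is a pullback. -/
theorem isPullback_map_section (F : C ⥤ D) [PreservesFiniteProducts F] {P X Z : C} (f : P ⟶ X)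
    (e : 𝟙_ C ⟶ Z) :
    IsPullback (F.map (lift (𝟙 P) (toUnit P ≫ e))) (F.map f) (F.map (f ▷ Z))
      (F.map (lift (𝟙 X) (toUnit X ≫ e))) := by
  have w : F.map (lift (𝟙 P) (toUnit P ≫ e)) ≫ F.map (f ▷ Z) =
      F.map f ≫ F.map (lift (𝟙 X) (toUnit X ≫ e)) := by
    rw [← F.map_comp, ← F.map_comp]
    congr 1
    ext <;> simp
  have hf : ∀ s : PullbackCone (F.map (f ▷ Z)) (F.map (lift (𝟙 X) (toUnit X ≫ e))),
      s.fst ≫ F.map (fst P Z ≫ f) = s.snd := fun s => by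
    have := s.condition =≫ F.map (fst _ _)
    simpa only [Category.assoc, ← F.map_comp, whiskerRight_fst, lift_fst, F.map_id,
      Category.comp_id] using this
  have hs : ∀ s : PullbackCone (F.map (f ▷ Z)) (F.map (lift (𝟙 X) (toUnit X ≫ e))),
      s.fst ≫ F.map (snd P Z) = s.snd ≫ F.map (toUnit X ≫ e) := fun s => by
    have := s.condition =≫ F.map (snd _ _)
    simpa only [Category.assoc, ← F.map_comp, whiskerRight_snd, lift_snd] using this
  refine ⟨⟨w⟩, ⟨PullbackCone.IsLimit.mk w (fun s => s.fst ≫ F.map (fst _ _)) ?_ ?_ ?_⟩⟩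
  · intro s
    apply map_prod_hom_ext F
    · simp only [Category.assoc, ← F.map_comp, lift_fst, Category.comp_id]
    · rw [hs, ← hf]
      simp only [Category.assoc, ← F.map_comp, lift_snd]
      rw [← Category.assoc f, comp_toUnit, ← Category.assoc, comp_toUnit]
  · intro s
    rw [← hf, Category.assoc, ← F.map_comp]
  · intro s m h₁ h₂
    rw [← h₁, Category.assoc, ← F.map_comp, lift_fst, F.map_id, Category.comp_id]

section Bundle

theorem prod_isPullback (X M : C) : IsPullback (X ◁ fst M M) (X ◁ snd M M) (fst X M) (fst X M) := by
  refine ⟨⟨by simp⟩, ⟨PullbackCone.IsLimit.mk (by simp)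
    (fun s => lift (s.fst ≫ fst _ _) (lift (s.fst ≫ snd _ _) (s.snd ≫ snd _ _))) ?_ ?_ ?_⟩⟩
  · intro s
    ext <;> simp
  · intro s
    have := s.condition
    ext <;> simp [this]
  · intro s m h₁ h₂
    have h₁' := h₁ =≫ snd _ _
    have h₂' := h₂ =≫ snd _ _
    have h₃' := h₁ =≫ fst _ _
    simp only [Category.assoc, whiskerLeft_snd, whiskerLeft_fst] at h₁' h₂' h₃'
    ext <;> simp [h₁', h₂', h₃']

theorem prod_pairing_mul (X M : C) [MonObj M] {Y : C} (a b : Y ⟶ X ⊗ M) (h : a ≫ fst X M = b ≫ fst X M) :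
    (prod_isPullback X M).lift a b h ≫ X ◁ μ[M] =
      lift (a ≫ fst X M) ((a ≫ snd X M) * (b ≫ snd X M)) := by
  have h₁ := (prod_isPullback X M).lift_fst a b h
  have h₂ := (prod_isPullback X M).lift_snd a b h
  have h₁' := h₁ =≫ snd _ _
  have h₂' := h₂ =≫ snd _ _
  have h₃' := h₁ =≫ fst _ _
  simp only [Category.assoc, whiskerLeft_snd, whiskerLeft_fst] at h₁' h₂' h₃'
  ext
  · simp [h₃']
  · rw [← h₁', ← h₂']
    simp [mul_eq_mul, MonObj.comp_mul]

/-- The additive bundle `X ⊗ M` over `X`, for a commutative monoid `M`. -/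
@[simps]
def prodBundle [BraidedCategory C] (X M : C) [MonObj M] [IsCommMonObj M] : AdditiveBundle X where
  total := X ⊗ M
  proj := fst X M
  pair := X ⊗ (M ⊗ M)
  fst := X ◁ fst M M
  snd := X ◁ snd M M
  add := X ◁ μ[M]
  zero := lift (𝟙 X) (toUnit X ≫ η[M])
  isAdditive :=
    { hasPowers := fun n => ⟨⟨_, (powerCone_isLimit X M n).some⟩⟩
      isPullback := prod_isPullback X M
      add_proj := by simp
      zero_proj := by simp
      add_assoc := by
        intro Y a b c hab hbc
        simp only [prod_pairing_mul]
        simp [_root_.mul_assoc]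
      zero_add := by
        rw [prod_pairing_mul]
        ext <;> simp [← Hom.one_def]
      add_zero := by
        rw [prod_pairing_mul]
        ext <;> simp [← Hom.one_def]
      add_comm := by
        rw [prod_pairing_mul]
        ext
        · simp
        · simp [mul_eq_mul, MonObj.comp_mul, _root_.mul_comm] }

end Bundle

end Products

section Assignments

/-- A linear assignment on a category with finite products: a finite product preserving
endofunctor `L`, a commutative monoid structure on every `L X` which is natural in `X`
(naturality of the sum and of the zero says that every `L f` is a monoid morphism), and natural
monoid isomorphisms `ν X : L (L X) ≅ L X` with `ν (L X) = L (ν X)`. -/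
structure LinearAssignment (C : Type u) [Category.{v} C] [CartesianMonoidalCategory C]
    [BraidedCategory C] where
  L : C ⥤ C
  [preservesFiniteProducts : PreservesFiniteProducts L]
  [mon (X : C) : MonObj (L.obj X)]
  [comm (X : C) : IsCommMonObj (L.obj X)]
  [map_isMonHom {X Y : C} (f : X ⟶ Y) : IsMonHom (L.map f)]
  ν (X : C) : L.obj (L.obj X) ≅ L.obj X
  ν_naturality {X Y : C} (f : X ⟶ Y) : L.map (L.map f) ≫ (ν Y).hom = (ν X).hom ≫ L.map f
  [ν_isMonHom (X : C) : IsMonHom (ν X).hom]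
  ν_L (X : C) : (ν (L.obj X)).hom = L.map (ν X).hom

/-- An additive assignment: a linear assignment with a natural negative making every `L X` an
abelian group. -/
structure AdditiveAssignment (C : Type u) [Category.{v} C] [CartesianMonoidalCategory C]
    [BraidedCategory C] extends LinearAssignment C where
  neg (X : C) : L.obj X ⟶ L.obj X
  neg_naturality {X Y : C} (f : X ⟶ Y) : L.map f ≫ neg Y = neg X ≫ L.map f
  add_neg (X : C) : lift (𝟙 (L.obj X)) (neg X) ≫ μ = toUnit (L.obj X) ≫ η
  neg_add (X : C) : lift (neg X) (𝟙 (L.obj X)) ≫ μ = toUnit (L.obj X) ≫ η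

namespace LinearAssignment

attribute [instance] preservesFiniteProducts mon comm map_isMonHom ν_isMonHom

variable {C : Type u} [Category.{v} C] [CartesianMonoidalCategory C] [BraidedCategory C]
  (𝓛 : LinearAssignment C)

/-- The tangent bundle functor `T X = X ⊗ L X`. -/
def T : C ⥤ C where
  obj X := X ⊗ 𝓛.L.obj X
  map f := f ⊗ₘ 𝓛.L.map f

/-- The functor `T₂ X = X ⊗ (L X ⊗ L X)`. -/
def T₂ : C ⥤ C where
  obj X := X ⊗ (𝓛.L.obj X ⊗ 𝓛.L.obj X)
  map f := f ⊗ₘ (𝓛.L.map f ⊗ₘ 𝓛.L.map f)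

theorem L_unit_ext {Y : C} (f g : Y ⟶ 𝓛.L.obj (𝟙_ C)) : f = g := by
  have : IsIso (CartesianMonoidalCategory.terminalComparison 𝓛.L) := inferInstance
  rw [← cancel_mono (CartesianMonoidalCategory.terminalComparison 𝓛.L)]
  exact toUnit_unique _ _

/-- `L` sends zero morphisms to zero morphisms. -/
theorem L_map_one {Y M : C} [MonObj M] : 𝓛.L.map (1 : Y ⟶ M) = 1 := by
  have h : 𝓛.L.map (toUnit Y) = 1 := 𝓛.L_unit_ext _ _
  rw [Hom.one_def, Functor.map_comp, h, MonObj.one_comp]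

/-- The image under `L` of the multiplication of `M` is the sum on `L M`. -/
theorem L_map_mul (M : C) [MonObj M] :
    𝓛.L.map μ[M] = 𝓛.L.map (fst M M) * 𝓛.L.map (snd M M) := by
  have h : 𝟙 (𝓛.L.obj (M ⊗ M)) =
      𝓛.L.map (lift (fst M M) 1) * 𝓛.L.map (lift 1 (snd M M)) := by
    apply map_prod_hom_ext 𝓛.L
    · rw [MonObj.mul_comp, ← Functor.map_comp, ← Functor.map_comp, lift_fst, lift_fst,
        L_map_one, _root_.mul_one, Category.id_comp]
    · rw [MonObj.mul_comp, ← Functor.map_comp, ← Functor.map_comp, lift_snd, lift_snd,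
        L_map_one, _root_.one_mul, Category.id_comp]
  rw [← Category.id_comp (𝓛.L.map μ[M]), h, MonObj.mul_comp, ← Functor.map_comp,
    ← Functor.map_comp, ← Hom.mul_def, ← Hom.mul_def, _root_.mul_one, _root_.one_mul]

/-- Morphisms into `T (X ⊗ M)` are determined by four components. -/
theorem T_ext {X M Y : C} {f g : Y ⟶ (X ⊗ M) ⊗ 𝓛.L.obj (X ⊗ M)}
    (h₁ : f ≫ fst _ _ ≫ fst _ _ = g ≫ fst _ _ ≫ fst _ _)
    (h₂ : f ≫ fst _ _ ≫ snd _ _ = g ≫ fst _ _ ≫ snd _ _)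
    (h₃ : f ≫ snd _ _ ≫ 𝓛.L.map (fst _ _) = g ≫ snd _ _ ≫ 𝓛.L.map (fst _ _))
    (h₄ : f ≫ snd _ _ ≫ 𝓛.L.map (snd _ _) = g ≫ snd _ _ ≫ 𝓛.L.map (snd _ _)) : f = g := by
  apply CartesianMonoidalCategory.hom_ext
  · apply CartesianMonoidalCategory.hom_ext <;> simpa
  · apply map_prod_hom_ext 𝓛.L <;> simpa

theorem T_comparison_isIso (A B : C) :
    IsIso (CartesianMonoidalCategory.prodComparison 𝓛.T A B) := by
  let i : (A ⊗ 𝓛.L.obj A) ⊗ (B ⊗ 𝓛.L.obj B) ⟶ (A ⊗ B) ⊗ 𝓛.L.obj (A ⊗ B) :=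
    lift (fst A _ ⊗ₘ fst B _) (mapLift 𝓛.L (fst _ _ ≫ snd A _) (snd _ _ ≫ snd B _))
  let j : (A ⊗ B) ⊗ 𝓛.L.obj (A ⊗ B) ⟶ (A ⊗ 𝓛.L.obj A) ⊗ (B ⊗ 𝓛.L.obj B) :=
    lift (fst A B ⊗ₘ 𝓛.L.map (fst A B)) (snd A B ⊗ₘ 𝓛.L.map (snd A B))
  have h₁ : j ≫ i = 𝟙 _ := by apply 𝓛.T_ext <;> simp [i, j]
  have h₂ : i ≫ j = 𝟙 _ := by
    apply CartesianMonoidalCategory.hom_ext <;> apply CartesianMonoidalCategory.hom_ext <;>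
      simp [i, j]
  exact ⟨i, h₁, h₂⟩

theorem T_terminalComparison_isIso :
    IsIso (CartesianMonoidalCategory.terminalComparison 𝓛.T) := by
  let i : 𝟙_ C ⟶ 𝟙_ C ⊗ 𝓛.L.obj (𝟙_ C) :=
    lift (𝟙 _) (inv (CartesianMonoidalCategory.terminalComparison 𝓛.L))
  have h : toUnit (𝟙_ C ⊗ 𝓛.L.obj (𝟙_ C)) ≫ i = 𝟙 _ := by
    apply CartesianMonoidalCategory.hom_ext
    · exact toUnit_unique _ _
    · exact 𝓛.L_unit_ext _ _
  exact ⟨i, h, toUnit_unique _ _⟩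

instance : PreservesFiniteProducts 𝓛.T := by
  have := 𝓛.T_terminalComparison_isIso
  have := 𝓛.T_comparison_isIso
  have : PreservesLimit (Functor.empty.{0} C) 𝓛.T :=
    preservesLimit_empty_of_isIso_terminalComparison _
  have : PreservesLimitsOfShape (Discrete PEmpty.{1}) 𝓛.T :=
    preservesLimitsOfShape_pempty_of_preservesTerminal _
  have := preservesLimitsOfShape_discrete_walkingPair_of_isIso_prodComparison 𝓛.T
  exact .of_preserves_binary_and_terminal _

theorem preserves_fst (X M : C) (n m : ℕ) :
    PreservesLimit (powerCospan (fst X M) n) (iter 𝓛.T m) := by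
  have := iter_preservesFiniteProducts 𝓛.T m
  exact preserves_powers _ X M n

/-- The additive part of the tangent structure: `p` is the first projection, and the sum and the
zero are those of `L X`. -/
def additiveTangentFunctor : AdditiveTangentFunctor C where
  T := 𝓛.T
  T₂ := 𝓛.T₂
  p X := fst X (𝓛.L.obj X)
  fst X := X ◁ fst _ _
  snd X := X ◁ snd _ _
  s X := X ◁ μ[𝓛.L.obj X]
  z X := lift (𝟙 X) (toUnit X ≫ η[𝓛.L.obj X])
  p_naturality f := tensorHom_fst _ _
  fst_naturality f := by
    change (f ⊗ₘ (𝓛.L.map f ⊗ₘ 𝓛.L.map f)) ≫ (_ ◁ fst _ _) = (_ ◁ fst _ _) ≫ (f ⊗ₘ 𝓛.L.map f)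
    ext <;> simp
  snd_naturality f := by
    change (f ⊗ₘ (𝓛.L.map f ⊗ₘ 𝓛.L.map f)) ≫ (_ ◁ snd _ _) = (_ ◁ snd _ _) ≫ (f ⊗ₘ 𝓛.L.map f)
    ext <;> simp
  s_naturality f := by
    change (f ⊗ₘ (𝓛.L.map f ⊗ₘ 𝓛.L.map f)) ≫ (_ ◁ μ) = (_ ◁ μ) ≫ (f ⊗ₘ 𝓛.L.map f)
    ext <;> simp
  z_naturality f := by
    change f ≫ lift (𝟙 _) (toUnit _ ≫ η) = lift (𝟙 _) (toUnit _ ≫ η) ≫ (f ⊗ₘ 𝓛.L.map f)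
    ext <;> simp
  isAdditive X := (prodBundle X (𝓛.L.obj X)).isAdditive
  preserves X n m := 𝓛.preserves_fst X _ n m

section Lift

variable (X A : C) [MonObj A] (a : 𝓛.L.obj A ≅ A)

/-- The lift `(⟨1, 0⟩ × ⟨0, a⁻¹⟩) ; (1 × ω⁻¹)` on `X ⊗ A`, where
`ω : L (X ⊗ A) ≅ L X ⊗ L A` is the canonical comparison. -/
noncomputable def prodLift : X ⊗ A ⟶ (X ⊗ A) ⊗ 𝓛.L.obj (X ⊗ A) :=
  (lift (𝟙 X) (toUnit X ≫ η[A]) ⊗ₘ lift (toUnit A ≫ η[𝓛.L.obj X]) a.inv) ≫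
    (X ⊗ A) ◁ inv (CartesianMonoidalCategory.prodComparison 𝓛.L X A)

theorem prodLift_eq : 𝓛.prodLift X A a =
    lift (lift (fst _ _) 1) (mapLift 𝓛.L 1 (snd _ _ ≫ a.inv)) := by
  apply 𝓛.T_ext <;> simp [prodLift, -tensor_whiskerLeft, ← Hom.one_def, MonObj.comp_one]

theorem prodLift_lift [IsMonHom a.hom] (h : 𝓛.L.map a.hom = (𝓛.ν A).hom) :
    𝓛.prodLift X A a ≫ (𝓛.prodLift X A a ⊗ₘ 𝓛.L.map (𝓛.prodLift X A a)) =
      𝓛.prodLift X A a ≫ 𝓛.prodLift (X ⊗ A) (𝓛.L.obj (X ⊗ A)) (𝓛.ν (X ⊗ A)) := by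
  have h' : 𝓛.L.map a.inv = (𝓛.ν A).inv := by
    rw [← cancel_mono (𝓛.ν A).hom, Iso.inv_hom_id, ← h, ← Functor.map_comp, Iso.inv_hom_id,
      CategoryTheory.Functor.map_id]
  have hν : ∀ {X Y : C} (f : X ⟶ Y), (𝓛.ν X).inv ≫ 𝓛.L.map (𝓛.L.map f) = 𝓛.L.map f ≫ (𝓛.ν Y).inv := by
    intro X Y f
    rw [Iso.inv_comp_eq, ← Category.assoc, Iso.eq_comp_inv, 𝓛.ν_naturality]
  have h1 : mapLift 𝓛.L (1 : X ⊗ A ⟶ 𝓛.L.obj X) (1 : X ⊗ A ⟶ 𝓛.L.obj A) = 1 := by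
    apply map_prod_hom_ext 𝓛.L <;> simp [MonObj.one_comp]
  simp only [prodLift_eq]
  apply 𝓛.T_ext
  · simp
  · simp [comp_mapLift, MonObj.comp_one, MonObj.one_comp, h1]
  · simp [comp_mapLift, MonObj.comp_one, MonObj.one_comp, ← Functor.map_comp, h1]
    apply map_prod_hom_ext 𝓛.L <;>
      simp [MonObj.one_comp, ← Functor.map_comp, L_map_one]
  · simp [MonObj.comp_one, ← Functor.map_comp]
    apply map_prod_hom_ext (𝓛.L ⋙ 𝓛.L)
    · simp [hν, MonObj.comp_one, MonObj.one_comp, ← Functor.map_comp, L_map_one]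
    · simp [hν, ← Functor.map_comp]
      simp [h']

/-- The morphism `⟨x, u, b⟩ ↦ ⟨(x, b), (0, a⁻¹ u)⟩`. -/
noncomputable def prodUniv : X ⊗ (A ⊗ A) ⟶ (X ⊗ A) ⊗ 𝓛.L.obj (X ⊗ A) :=
  lift (lift (fst _ _) (snd _ _ ≫ snd _ _)) (mapLift 𝓛.L 1 (snd _ _ ≫ fst _ _ ≫ a.inv))

theorem prodUniv_isPullback [IsMonHom a.hom] (m : ℕ) :
    IsPullback ((iter 𝓛.T m).map (𝓛.prodUniv X A a)) ((iter 𝓛.T m).map (fst X (A ⊗ A)))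
      ((iter 𝓛.T m).map (fst X A ⊗ₘ 𝓛.L.map (fst X A)))
      ((iter 𝓛.T m).map (lift (𝟙 X) (toUnit X ≫ η[𝓛.L.obj X]))) := by
  have := iter_preservesFiniteProducts 𝓛.T m
  let f : (X ⊗ (A ⊗ A)) ⊗ 𝓛.L.obj X ⟶ (X ⊗ A) ⊗ 𝓛.L.obj (X ⊗ A) :=
    lift (lift (fst _ _ ≫ fst _ _) (fst _ _ ≫ snd _ _ ≫ snd _ _))
      (mapLift 𝓛.L (snd _ _) (fst _ _ ≫ snd _ _ ≫ fst _ _ ≫ a.inv))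
  let g : (X ⊗ A) ⊗ 𝓛.L.obj (X ⊗ A) ⟶ (X ⊗ (A ⊗ A)) ⊗ 𝓛.L.obj X :=
    lift (lift (fst _ _ ≫ fst _ _)
      (lift (snd _ _ ≫ 𝓛.L.map (snd _ _) ≫ a.hom) (fst _ _ ≫ snd _ _)))
      (snd _ _ ≫ 𝓛.L.map (fst _ _))
  let e : (X ⊗ (A ⊗ A)) ⊗ 𝓛.L.obj X ≅ (X ⊗ A) ⊗ 𝓛.L.obj (X ⊗ A) :=
    ⟨f, g, by ext <;> simp [f, g], by apply 𝓛.T_ext <;> simp [f, g]⟩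
  refine (isPullback_map_section (iter 𝓛.T m) (fst X (A ⊗ A)) η[𝓛.L.obj X]).of_iso
    (Iso.refl _) ((iter 𝓛.T m).mapIso e) (Iso.refl _) (Iso.refl _) ?_ ?_ ?_ ?_
  · change _ ≫ (iter 𝓛.T m).map f = 𝟙 _ ≫ _
    rw [← Functor.map_comp, Category.id_comp]
    congr 1
    apply 𝓛.T_ext <;> simp [f, prodUniv, Hom.one_def]
  · simp
  · change _ ≫ 𝟙 _ = (iter 𝓛.T m).map f ≫ _
    rw [← Functor.map_comp, Category.comp_id]
    congr 1
    ext <;> simp [f]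
  · simp

variable [IsCommMonObj A]

theorem prodLift_isHom_tangent [IsMonHom a.hom] : (prodBundle X A).IsHom
    (𝓛.additiveTangentFunctor.bundle (X ⊗ A)) (𝓛.prodLift X A a)
    (lift (𝟙 X) (toUnit X ≫ η[A])) := by
  rw [prodLift_eq]
  refine AdditiveBundle.IsHom.of_pair (B := prodBundle X A)
    (B' := 𝓛.additiveTangentFunctor.bundle (X ⊗ A)) ?_
    (lift (lift (fst _ _) 1)
      (lift (mapLift 𝓛.L 1 (snd _ _ ≫ fst _ _ ≫ a.inv))
        (mapLift 𝓛.L 1 (snd _ _ ≫ snd _ _ ≫ a.inv))) :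
      X ⊗ (A ⊗ A) ⟶ (X ⊗ A) ⊗ (𝓛.L.obj (X ⊗ A) ⊗ 𝓛.L.obj (X ⊗ A))) ?_ ?_ ?_ ?_
  · change lift _ _ ≫ fst _ _ = fst _ _ ≫ _
    rw [lift_fst]
    ext <;> simp [← Hom.one_def, MonObj.comp_one]
  · change lift _ _ ≫ (X ⊗ A) ◁ (fst _ _) = X ◁ fst A A ≫ _
    apply 𝓛.T_ext <;> simp [-tensor_whiskerLeft, MonObj.comp_one]
  · change lift _ _ ≫ (X ⊗ A) ◁ (snd _ _) = X ◁ snd A A ≫ _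
    apply 𝓛.T_ext <;> simp [-tensor_whiskerLeft, MonObj.comp_one]
  · change X ◁ μ[A] ≫ _ = lift _ _ ≫ (X ⊗ A) ◁ μ
    have : snd X (A ⊗ A) ≫ (a.inv ⊗ₘ a.inv) ≫ μ =
        (snd _ _ ≫ fst _ _ ≫ a.inv) * (snd _ _ ≫ snd _ _ ≫ a.inv) := by
      rw [← IsMonHom.mul_hom, mul_eq_mul, MonObj.mul_comp, MonObj.comp_mul]
    apply 𝓛.T_ext <;> simp [-tensor_whiskerLeft, MonObj.comp_one, this, ← Hom.mul_def, MonObj.mul_comp]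
  · change lift (𝟙 X) (toUnit X ≫ η[A]) ≫ _ =
      lift (𝟙 X) (toUnit X ≫ η[A]) ≫ lift (𝟙 _) (toUnit _ ≫ η)
    apply 𝓛.T_ext <;> simp [← Hom.one_def, MonObj.comp_one, MonObj.one_comp]

theorem prodLift_isHom_map [IsMonHom a.hom] : (prodBundle X A).IsHom
    (𝓛.additiveTangentFunctor.mapBundle (prodBundle X A) (𝓛.preserves_fst X A)) (𝓛.prodLift X A a)
    (𝓛.additiveTangentFunctor.z X) := by
  rw [prodLift_eq]
  refine AdditiveBundle.IsHom.of_pair (B := prodBundle X A)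
    (B' := 𝓛.additiveTangentFunctor.mapBundle (prodBundle X A) (𝓛.preserves_fst X A)) ?_
    (lift (lift (fst _ _) 1)
      (mapLift 𝓛.L 1 (mapLift 𝓛.L (snd _ _ ≫ fst _ _ ≫ a.inv) (snd _ _ ≫ snd _ _ ≫ a.inv))) :
      X ⊗ (A ⊗ A) ⟶ (X ⊗ (A ⊗ A)) ⊗ (𝓛.L.obj (X ⊗ (A ⊗ A)))) ?_ ?_ ?_ ?_
  · change lift _ _ ≫ (fst X A ⊗ₘ 𝓛.L.map (fst X A)) = fst X A ≫ lift (𝟙 X) (toUnit X ≫ η)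
    ext <;> simp [← Hom.one_def, MonObj.comp_one]
  · change lift _ _ ≫ (X ◁ fst A A ⊗ₘ 𝓛.L.map (X ◁ fst A A)) = X ◁ fst A A ≫ _
    apply 𝓛.T_ext <;> simp [-tensor_whiskerLeft, MonObj.comp_one, MonObj.one_comp, ← Functor.map_comp]
    simp
  · change lift _ _ ≫ (X ◁ snd A A ⊗ₘ 𝓛.L.map (X ◁ snd A A)) = X ◁ snd A A ≫ _
    apply 𝓛.T_ext <;> simp [-tensor_whiskerLeft, MonObj.comp_one, MonObj.one_comp, ← Functor.map_comp]
    simp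
  · change X ◁ μ[A] ≫ _ = lift _ _ ≫ (X ◁ μ ⊗ₘ 𝓛.L.map (X ◁ μ))
    have : snd X (A ⊗ A) ≫ (a.inv ⊗ₘ a.inv) ≫ μ =
        (snd _ _ ≫ fst _ _ ≫ a.inv) * (snd _ _ ≫ snd _ _ ≫ a.inv) := by
      rw [← IsMonHom.mul_hom, mul_eq_mul, MonObj.mul_comp, MonObj.comp_mul]
    apply 𝓛.T_ext <;> simp [-tensor_whiskerLeft, MonObj.comp_one, MonObj.one_comp, this, ← Functor.map_comp]
    simp [L_map_mul, MonObj.comp_mul]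
  · change lift (𝟙 X) (toUnit X ≫ η[A]) ≫ _ =
      lift (𝟙 X) (toUnit X ≫ η) ≫ (lift (𝟙 X) (toUnit X ≫ η[A]) ⊗ₘ 𝓛.L.map (lift (𝟙 X) (toUnit X ≫ η[A])))
    apply 𝓛.T_ext <;> simp [← Hom.one_def, MonObj.comp_one, MonObj.one_comp]

theorem prodUniv_eq [IsMonHom a.hom] (h) :
    ((𝓛.additiveTangentFunctor.mapBundle (prodBundle X A) (𝓛.preserves_fst X A)).pairing
      (X ◁ fst A A ≫ 𝓛.prodLift X A a) (X ◁ snd A A ≫ 𝓛.additiveTangentFunctor.z (X ⊗ A)) h ≫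
        𝓛.additiveTangentFunctor.T.map (X ◁ μ[A])) = 𝓛.prodUniv X A a := by
  let k : X ⊗ (A ⊗ A) ⟶ (X ⊗ (A ⊗ A)) ⊗ 𝓛.L.obj (X ⊗ (A ⊗ A)) :=
    lift (lift (fst _ _) (lift 1 (snd _ _ ≫ snd _ _)))
      (mapLift 𝓛.L 1 (mapLift 𝓛.L (snd _ _ ≫ fst _ _ ≫ a.inv) 1))
  have hk : (𝓛.additiveTangentFunctor.mapBundle (prodBundle X A) (𝓛.preserves_fst X A)).pairing
      (X ◁ fst A A ≫ 𝓛.prodLift X A a) (X ◁ snd A A ≫ 𝓛.additiveTangentFunctor.z (X ⊗ A)) h =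
        k := by
    apply AdditiveBundle.pair_hom_ext
    · rw [AdditiveBundle.pairing_fst, prodLift_eq]
      change X ◁ fst A A ≫ lift (lift (fst _ _) 1) (mapLift 𝓛.L 1 (snd _ _ ≫ a.inv)) =
        k ≫ (X ◁ fst A A ⊗ₘ 𝓛.L.map (X ◁ fst A A))
      symm
      apply 𝓛.T_ext <;> simp [k, -tensor_whiskerLeft, ← Functor.map_comp]
      simp
    · rw [AdditiveBundle.pairing_snd]
      change X ◁ snd A A ≫ lift (𝟙 _) (toUnit _ ≫ η) = k ≫ (X ◁ snd A A ⊗ₘ 𝓛.L.map (X ◁ snd A A))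
      symm
      apply 𝓛.T_ext <;> simp [k, -tensor_whiskerLeft, MonObj.comp_one, ← Functor.map_comp,
        ← Hom.one_def]
      simp
  rw [hk]
  change k ≫ (X ◁ μ[A] ⊗ₘ 𝓛.L.map (X ◁ μ[A])) = _
  apply 𝓛.T_ext
  · simp [k, prodUniv]
  · simp [k, prodUniv, ← Hom.mul_def]
  · simp [k, prodUniv, ← Functor.map_comp]
  · simp [k, prodUniv, ← Functor.map_comp]
    simp [L_map_mul, MonObj.comp_mul]

theorem prod_lift_universal [IsMonHom a.hom] (m : ℕ) :
    ∃ h, IsPullback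
    ((iter 𝓛.T m).map ((𝓛.additiveTangentFunctor.mapBundle (prodBundle X A)
      (𝓛.preserves_fst X A)).pairing (X ◁ fst A A ≫ 𝓛.prodLift X A a)
        (X ◁ snd A A ≫ 𝓛.additiveTangentFunctor.z (X ⊗ A)) h ≫
          𝓛.additiveTangentFunctor.T.map (X ◁ μ[A])))
    ((iter 𝓛.T m).map (X ◁ fst A A ≫ fst X A))
    ((iter 𝓛.T m).map (𝓛.additiveTangentFunctor.T.map (fst X A)))
    ((iter 𝓛.T m).map (𝓛.additiveTangentFunctor.z X)) := by
  refine ⟨?_, ?_⟩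
  · change (X ◁ fst A A ≫ 𝓛.prodLift X A a) ≫ (fst X A ⊗ₘ 𝓛.L.map (fst X A)) =
      (X ◁ snd A A ≫ lift (𝟙 (X ⊗ A)) (toUnit (X ⊗ A) ≫ η)) ≫ (fst X A ⊗ₘ 𝓛.L.map (fst X A))
    rw [prodLift_eq]
    ext <;> simp [← Hom.one_def, MonObj.one_comp, MonObj.comp_one]
  · rw [prodUniv_eq, whiskerLeft_fst]
    exact 𝓛.prodUniv_isPullback X A a m

end Lift

theorem prodLift_naturality {X X' A A' : C} [MonObj A] [MonObj A'] (a : 𝓛.L.obj A ≅ A)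
    (a' : 𝓛.L.obj A' ≅ A') (g : X ⟶ X') (f : A ⟶ A') [IsMonHom f]
    (h : 𝓛.L.map f ≫ a'.hom = a.hom ≫ f) :
    (g ⊗ₘ f) ≫ 𝓛.prodLift X' A' a' = 𝓛.prodLift X A a ≫ ((g ⊗ₘ f) ⊗ₘ 𝓛.L.map (g ⊗ₘ f)) := by
  have h' : f ≫ a'.inv = a.inv ≫ 𝓛.L.map f := by
    rw [Iso.comp_inv_eq, Category.assoc, h, Iso.inv_hom_id_assoc]
  simp only [prodLift_eq]
  apply 𝓛.T_ext
  · simp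
  · simp [MonObj.comp_one, MonObj.one_comp]
  · simp [MonObj.comp_one, ← Functor.map_comp]
    simp [MonObj.one_comp]
  · simp [← Functor.map_comp]
    simp [h']

/-- The canonical flip `(1 × ω) ; τ ; (1 × ω⁻¹)`, where `τ` interchanges the middle factors. -/
noncomputable def flip (X : C) :
    (X ⊗ 𝓛.L.obj X) ⊗ 𝓛.L.obj (X ⊗ 𝓛.L.obj X) ⟶ (X ⊗ 𝓛.L.obj X) ⊗ 𝓛.L.obj (X ⊗ 𝓛.L.obj X) :=
  (X ⊗ 𝓛.L.obj X) ◁ CartesianMonoidalCategory.prodComparison 𝓛.L X (𝓛.L.obj X) ≫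
    tensorμ X (𝓛.L.obj X) (𝓛.L.obj X) (𝓛.L.obj (𝓛.L.obj X)) ≫
    (X ⊗ 𝓛.L.obj X) ◁ inv (CartesianMonoidalCategory.prodComparison 𝓛.L X (𝓛.L.obj X))

theorem flip_eq (X : C) : 𝓛.flip X =
    lift (lift (fst _ _ ≫ fst _ _) (snd _ _ ≫ 𝓛.L.map (fst _ _)))
      (mapLift 𝓛.L (fst _ _ ≫ snd _ _) (snd _ _ ≫ 𝓛.L.map (snd _ _))) := by
  apply 𝓛.T_ext <;> simp [flip, -tensor_whiskerLeft]

/-- Morphisms into `T (T (T X))` are determined by eight components. -/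
theorem T_T_ext {X Y : C}
    {f g : Y ⟶ ((X ⊗ 𝓛.L.obj X) ⊗ 𝓛.L.obj (X ⊗ 𝓛.L.obj X)) ⊗
      𝓛.L.obj ((X ⊗ 𝓛.L.obj X) ⊗ 𝓛.L.obj (X ⊗ 𝓛.L.obj X))}
    (h₁ : f ≫ fst _ _ = g ≫ fst _ _)
    (h₂ : f ≫ snd _ _ ≫ 𝓛.L.map (fst _ _) ≫ 𝓛.L.map (fst _ _) =
      g ≫ snd _ _ ≫ 𝓛.L.map (fst _ _) ≫ 𝓛.L.map (fst _ _))
    (h₃ : f ≫ snd _ _ ≫ 𝓛.L.map (fst _ _) ≫ 𝓛.L.map (snd _ _) =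
      g ≫ snd _ _ ≫ 𝓛.L.map (fst _ _) ≫ 𝓛.L.map (snd _ _))
    (h₄ : f ≫ snd _ _ ≫ 𝓛.L.map (snd _ _) ≫ 𝓛.L.map (𝓛.L.map (fst _ _)) =
      g ≫ snd _ _ ≫ 𝓛.L.map (snd _ _) ≫ 𝓛.L.map (𝓛.L.map (fst _ _)))
    (h₅ : f ≫ snd _ _ ≫ 𝓛.L.map (snd _ _) ≫ 𝓛.L.map (𝓛.L.map (snd _ _)) =
      g ≫ snd _ _ ≫ 𝓛.L.map (snd _ _) ≫ 𝓛.L.map (𝓛.L.map (snd _ _))) : f = g := by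
  apply CartesianMonoidalCategory.hom_ext
  · exact h₁
  · apply map_prod_hom_ext 𝓛.L
    · apply map_prod_hom_ext 𝓛.L <;> simpa
    · apply map_prod_hom_ext (𝓛.L ⋙ 𝓛.L) <;> simpa

theorem flip_naturality {X Y : C} (f : X ⟶ Y) :
    ((f ⊗ₘ 𝓛.L.map f) ⊗ₘ 𝓛.L.map (f ⊗ₘ 𝓛.L.map f)) ≫ 𝓛.flip Y =
      𝓛.flip X ≫ ((f ⊗ₘ 𝓛.L.map f) ⊗ₘ 𝓛.L.map (f ⊗ₘ 𝓛.L.map f)) := by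
  simp only [flip_eq]
  apply 𝓛.T_ext <;> simp [← Functor.map_comp] <;> simp

theorem flip_flip (X : C) : 𝓛.flip X ≫ 𝓛.flip X = 𝟙 _ := by
  simp only [flip_eq]
  apply 𝓛.T_ext <;> simp

theorem flip_yangBaxter (X : C) :
    (𝓛.flip X ⊗ₘ 𝓛.L.map (𝓛.flip X)) ≫ 𝓛.flip (X ⊗ 𝓛.L.obj X) ≫
        (𝓛.flip X ⊗ₘ 𝓛.L.map (𝓛.flip X)) =
      𝓛.flip (X ⊗ 𝓛.L.obj X) ≫ (𝓛.flip X ⊗ₘ 𝓛.L.map (𝓛.flip X)) ≫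
        𝓛.flip (X ⊗ 𝓛.L.obj X) := by
  simp only [flip_eq]
  apply 𝓛.T_T_ext
  · apply 𝓛.T_ext <;> simp [← Functor.map_comp]
    · simp
    · simp
  · simp [← Functor.map_comp]
    try simp
    try simp [← Functor.map_comp]
    try simp
  · simp [← Functor.map_comp]
    try simp
    try simp [← Functor.map_comp]
    try simp
  · simp [← Functor.map_comp]
    try simp
    try simp [← Functor.map_comp]
    try simp
  · simp [← Functor.map_comp]
    try simp
    try simp [← Functor.map_comp]
    try simp

theorem flip_isHom (X : C) :
    (𝓛.additiveTangentFunctor.mapBundle (𝓛.additiveTangentFunctor.bundle X)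
      (𝓛.additiveTangentFunctor.preserves X)).IsHom
      (𝓛.additiveTangentFunctor.bundle (X ⊗ 𝓛.L.obj X)) (𝓛.flip X) (𝟙 (X ⊗ 𝓛.L.obj X)) := by
  refine AdditiveBundle.IsHom.of_pair (B := 𝓛.additiveTangentFunctor.mapBundle
      (𝓛.additiveTangentFunctor.bundle X) (𝓛.additiveTangentFunctor.preserves X))
    (B' := 𝓛.additiveTangentFunctor.bundle (X ⊗ 𝓛.L.obj X)) ?_
    (lift (lift (fst _ _ ≫ fst _ _) (snd _ _ ≫ 𝓛.L.map (fst _ _)))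
      (lift (mapLift 𝓛.L (fst _ _ ≫ snd _ _ ≫ fst _ _)
          (snd _ _ ≫ 𝓛.L.map (snd _ _) ≫ 𝓛.L.map (fst _ _)))
        (mapLift 𝓛.L (fst _ _ ≫ snd _ _ ≫ snd _ _)
          (snd _ _ ≫ 𝓛.L.map (snd _ _) ≫ 𝓛.L.map (snd _ _)))) :
      (X ⊗ (𝓛.L.obj X ⊗ 𝓛.L.obj X)) ⊗ 𝓛.L.obj (X ⊗ (𝓛.L.obj X ⊗ 𝓛.L.obj X)) ⟶
        (X ⊗ 𝓛.L.obj X) ⊗ (𝓛.L.obj (X ⊗ 𝓛.L.obj X) ⊗ 𝓛.L.obj (X ⊗ 𝓛.L.obj X))) ?_ ?_ ?_ ?_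
  · change 𝓛.flip X ≫ fst _ _ =
      (fst X (𝓛.L.obj X) ⊗ₘ 𝓛.L.map (fst X (𝓛.L.obj X))) ≫ 𝟙 _
    rw [flip_eq]
    ext <;> simp
  · change _ ≫ (X ⊗ 𝓛.L.obj X) ◁ fst _ _ = (X ◁ fst (𝓛.L.obj X) (𝓛.L.obj X) ⊗ₘ 𝓛.L.map (X ◁ fst (𝓛.L.obj X) (𝓛.L.obj X))) ≫
      𝓛.flip X
    rw [flip_eq]
    apply 𝓛.T_ext <;> simp [-tensor_whiskerLeft, ← Functor.map_comp]
  · change _ ≫ (X ⊗ 𝓛.L.obj X) ◁ snd _ _ = (X ◁ snd (𝓛.L.obj X) (𝓛.L.obj X) ⊗ₘ 𝓛.L.map (X ◁ snd (𝓛.L.obj X) (𝓛.L.obj X))) ≫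
      𝓛.flip X
    rw [flip_eq]
    apply 𝓛.T_ext <;> simp [-tensor_whiskerLeft, ← Functor.map_comp]
  · change (X ◁ μ ⊗ₘ 𝓛.L.map (X ◁ μ)) ≫ 𝓛.flip X = _ ≫ (X ⊗ 𝓛.L.obj X) ◁ μ
    rw [flip_eq]
    apply 𝓛.T_ext <;> simp [-tensor_whiskerLeft, ← Functor.map_comp]
    · simp [mul_eq_mul, MonObj.comp_mul]
    · simp [← Hom.mul_def, L_map_mul, MonObj.comp_mul]
  · change (lift (𝟙 X) (toUnit X ≫ η) ⊗ₘ 𝓛.L.map (lift (𝟙 X) (toUnit X ≫ η))) ≫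
      𝓛.flip X =
      𝟙 _ ≫ lift (𝟙 _) (toUnit _ ≫ η)
    rw [flip_eq]
    apply 𝓛.T_ext <;> simp [← Hom.one_def, ← Functor.map_comp, MonObj.one_comp, MonObj.comp_one, L_map_one]

theorem prodLift_flip (X : C) :
    𝓛.prodLift X (𝓛.L.obj X) (𝓛.ν X) ≫ 𝓛.flip X = 𝓛.prodLift X (𝓛.L.obj X) (𝓛.ν X) := by
  simp only [prodLift_eq, flip_eq]
  apply 𝓛.T_ext <;> simp

theorem prodLift_T_flip (X : C) :
    𝓛.prodLift (X ⊗ 𝓛.L.obj X) (𝓛.L.obj (X ⊗ 𝓛.L.obj X)) (𝓛.ν (X ⊗ 𝓛.L.obj X)) ≫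
        (𝓛.flip X ⊗ₘ 𝓛.L.map (𝓛.flip X)) ≫ 𝓛.flip (X ⊗ 𝓛.L.obj X) =
      𝓛.flip X ≫ (𝓛.prodLift X (𝓛.L.obj X) (𝓛.ν X) ⊗ₘ
        𝓛.L.map (𝓛.prodLift X (𝓛.L.obj X) (𝓛.ν X))) := by
  have hν : ∀ {X Y : C} (f : X ⟶ Y),
      (𝓛.ν X).inv ≫ 𝓛.L.map (𝓛.L.map f) = 𝓛.L.map f ≫ (𝓛.ν Y).inv := by
    intro X Y f
    rw [Iso.inv_comp_eq, ← Category.assoc, Iso.eq_comp_inv, 𝓛.ν_naturality]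
  have h' : 𝓛.L.map (𝓛.ν X).inv = (𝓛.ν (𝓛.L.obj X)).inv := by
    rw [← cancel_mono (𝓛.ν (𝓛.L.obj X)).hom, Iso.inv_hom_id, 𝓛.ν_L, ← Functor.map_comp,
      Iso.inv_hom_id, CategoryTheory.Functor.map_id]
  simp only [prodLift_eq, flip_eq]
  apply 𝓛.T_T_ext
  · apply 𝓛.T_ext <;> simp [← Functor.map_comp, MonObj.comp_one, MonObj.one_comp]
    · simp [MonObj.one_comp]
    · simp [hν]
  · simp [← Functor.map_comp]
    simp
  · simp [← Functor.map_comp]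
    simp
    simp [MonObj.comp_one, L_map_one]
  · simp [← Functor.map_comp]
    simp
    simp [← Functor.map_comp, MonObj.comp_one, L_map_one]
    simp [MonObj.one_comp]
  · simp [← Functor.map_comp]
    simp
    simp [← Functor.map_comp]
    simp [hν, h']

/-- The tangent structure `𝕋_𝓛` induced by a linear assignment `𝓛`. -/
noncomputable def tangentStructure : TangentStructure C where
  toAdditiveTangentFunctor := 𝓛.additiveTangentFunctor
  ℓ X := 𝓛.prodLift X (𝓛.L.obj X) (𝓛.ν X)
  ℓ_naturality f := 𝓛.prodLift_naturality _ _ f (𝓛.L.map f) (𝓛.ν_naturality f)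
  ℓ_isHom X := 𝓛.prodLift_isHom_map X (𝓛.L.obj X) (𝓛.ν X)
  ℓ_ℓ X := (𝓛.prodLift_lift X (𝓛.L.obj X) (𝓛.ν X) (𝓛.ν_L X).symm).symm
  ℓ_universal X := (𝓛.prod_lift_universal X (𝓛.L.obj X) (𝓛.ν X) 0).2
  c X := 𝓛.flip X
  c_naturality f := 𝓛.flip_naturality f
  c_c X := 𝓛.flip_flip X
  c_yangBaxter X := 𝓛.flip_yangBaxter X
  c_isHom X := 𝓛.flip_isHom X
  ℓ_c X := 𝓛.prodLift_flip X
  ℓ_T_c X := 𝓛.prodLift_T_flip X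

/-- Linear algebras: isomorphisms `a : L A ≅ A` with `L a = ν A`. -/
structure Algebra where
  obj : C
  str : 𝓛.L.obj obj ≅ obj
  map_str : 𝓛.L.map str.hom = (𝓛.ν obj).hom

namespace Algebra

variable {𝓛}

/-- Morphisms of linear algebras. -/
@[ext]
structure Hom (A B : 𝓛.Algebra) where
  hom : A.obj ⟶ B.obj
  comm : 𝓛.L.map hom ≫ B.str.hom = A.str.hom ≫ hom

instance : Category 𝓛.Algebra where
  Hom := Hom
  id A := ⟨𝟙 _, by simp⟩
  comp f g := ⟨f.hom ≫ g.hom, by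
    rw [Functor.map_comp, Category.assoc, g.comm, ← Category.assoc, f.comm, Category.assoc]⟩
  id_comp f := Hom.ext (Category.id_comp _)
  comp_id f := Hom.ext (Category.comp_id _)
  assoc f g h := Hom.ext (Category.assoc _ _ _)

variable (A : 𝓛.Algebra)

/-- The commutative monoid structure on a linear algebra, transported along `a : L A ≅ A`. -/
instance : MonObj A.obj := MonObj.ofIso A.str

instance : IsMonHom A.str.hom := isMonHom_ofIso A.str

instance : IsCommMonObj A.obj where
  mul_comm := by
    have h : μ[A.obj] = (A.str.inv ⊗ₘ A.str.inv) ≫ μ ≫ A.str.hom := rfl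
    rw [h, ← Category.assoc, ← BraidedCategory.braiding_naturality]
    rw [Category.assoc, IsCommMonObj.mul_comm_assoc]

instance {A B : 𝓛.Algebra} (f : A ⟶ B) : IsMonHom f.hom := by
  have h : f.hom = A.str.inv ≫ 𝓛.L.map f.hom ≫ B.str.hom := by
    rw [Iso.eq_inv_comp, f.comm]
  rw [h]
  infer_instance

end Algebra

/-- The differential bundle `X ⊗ A` over `X`, for a linear algebra `A`. -/
noncomputable def prodDifferentialBundle (X : C) (A : 𝓛.Algebra) :
    DifferentialBundle 𝓛.tangentStructure X where
  toAdditiveBundle := prodBundle X A.obj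
  preserves := 𝓛.preserves_fst X A.obj
  lift := 𝓛.prodLift X A.obj A.str
  lift_isHom_map := 𝓛.prodLift_isHom_map X A.obj A.str
  lift_isHom_tangent := 𝓛.prodLift_isHom_tangent X A.obj A.str
  lift_lift := 𝓛.prodLift_lift X A.obj A.str A.map_str
  lift_universal m := (𝓛.prod_lift_universal X A.obj A.str m).2

/-- The functor `𝓓` with `𝓓 (X, A) = X ⊗ A` and `𝓓 (g, f) = (g ⊗ f, g)`. -/
noncomputable def toDBun : C × 𝓛.Algebra ⥤ DBun 𝓛.tangentStructure where
  obj P := ⟨P.1, 𝓛.prodDifferentialBundle P.1 P.2⟩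
  map {P Q} φ :=
    { total := φ.1 ⊗ₘ φ.2.hom
      base := φ.1
      comm := tensorHom_fst _ _
      lift := (𝓛.prodLift_naturality P.2.str Q.2.str φ.1 φ.2.hom φ.2.comm).symm }
  map_id _ := LinearMorphism.ext (id_tensorHom_id _ _) rfl
  map_comp _ _ := LinearMorphism.ext (tensorHom_comp_tensorHom _ _ _ _).symm rfl

/-- The functor `𝓓_X` with `𝓓_X A = X ⊗ A` and `𝓓_X f = X ⊗ f`. -/
noncomputable def toDBunOver (X : C) :
    𝓛.Algebra ⥤ DifferentialBundle 𝓛.tangentStructure X where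
  obj A := 𝓛.prodDifferentialBundle X A
  map {A B} f :=
    { hom := 𝟙 X ⊗ₘ f.hom
      comm := (tensorHom_fst _ _).trans (Category.comp_id _)
      lift := (𝓛.prodLift_naturality A.str B.str (𝟙 X) f.hom f.comm).symm }
  map_id _ := LinearMorphismOver.ext (id_tensorHom_id _ _)
  map_comp _ _ := LinearMorphismOver.ext
    ((congrArg (· ⊗ₘ _) (Category.comp_id (𝟙 X)).symm).trans (tensorHom_comp_tensorHom _ _ _ _).symm)

end LinearAssignment

/-- The Rosický tangent structure induced by an additive assignment. -/
noncomputable def AdditiveAssignment.rosickyTangentStructure {C : Type u} [Category.{v} C]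
    [CartesianMonoidalCategory C] [BraidedCategory C] (𝓛 : AdditiveAssignment C) :
    RosickyTangentStructure C where
  toTangentStructure := 𝓛.toLinearAssignment.tangentStructure
  n X := X ◁ 𝓛.neg X
  n_naturality {X Y} f := by
    change (f ⊗ₘ 𝓛.L.map f) ≫ Y ◁ 𝓛.neg Y = X ◁ 𝓛.neg X ≫ (f ⊗ₘ 𝓛.L.map f)
    ext <;> simp [𝓛.neg_naturality]
  n_p X := whiskerLeft_fst _ _
  add_n X := by
    refine (prod_pairing_mul X (𝓛.L.obj X) (𝟙 (X ⊗ 𝓛.L.obj X)) (X ◁ 𝓛.neg X) (by simp)).trans ?_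
    change _ = fst X (𝓛.L.obj X) ≫ lift (𝟙 X) (toUnit X ≫ η)
    ext
    · simp
    · have h : (snd X (𝓛.L.obj X)) * (snd X (𝓛.L.obj X) ≫ 𝓛.neg X) =
          snd X (𝓛.L.obj X) ≫ lift (𝟙 _) (𝓛.neg X) ≫ μ := by
        rw [Hom.mul_def, ← Category.assoc, comp_lift, Category.comp_id]
      simp [h, 𝓛.add_neg]
  n_add X := by
    refine (prod_pairing_mul X (𝓛.L.obj X) (X ◁ 𝓛.neg X) (𝟙 (X ⊗ 𝓛.L.obj X)) (by simp)).trans ?_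
    change _ = fst X (𝓛.L.obj X) ≫ lift (𝟙 X) (toUnit X ≫ η)
    ext
    · simp
    · have h : (snd X (𝓛.L.obj X) ≫ 𝓛.neg X) * (snd X (𝓛.L.obj X)) =
          snd X (𝓛.L.obj X) ≫ lift (𝓛.neg X) (𝟙 _) ≫ μ := by
        rw [Hom.mul_def, ← Category.assoc, comp_lift, Category.comp_id]
      simp [h, 𝓛.neg_add]

end Assignments
end TangentCat

open TangentCat

namespace TangentCat

/-! ### Zero morphisms and finite products -/

section ZeroMorphisms

variable {C : Type u} [Category.{v} C] [CartesianMonoidalCategory C] [HasZeroMorphisms C]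

/-! Composition is written in diagrammatic order, and `q`, `ζ`, `λ` denote the projection, zero and
lift of a differential bundle `E` over `X`. Since `T E = E ⊗ L E`, the lift is a pair `λ = ⟨q ≫ ζ,
v⟩`, so all its information lies in `v = vert B : E ⟶ L E`. The axioms become `v ≫ L q = 0`, `ζ ≫ v
= 0` and `v ≫ L v = v ≫ ν⁻¹`.

The decisive point is universality. The unit laws of the bundle turn the map `E₂ ⟶ T E` of the
universal square into `⟨ρ₂, ρ₁ ≫ v⟩` (`lift_add_eq`). That this square is a pullback means that a
morphism `Y ⟶ E` is the same thing as a pair of a morphism `x : Y ⟶ X` and a `w : Y ⟶ L E` killed by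
`L q`, through `e ↦ (e ≫ q, e ≫ v)` (`hom_ext_vert`, `exists_lift_vert`). The condition on `w` does
not involve `x`, so every bundle is trivial.

Taking `x = 0` shows that `A = ker q`, with inclusion `ι`, is also a kernel of `L q`. The pair `(0,
v)` gives a retraction `r : E ⟶ A`, and `⟨q, r⟩` is an isomorphism `E ≅ X ⊗ A` (`trivialization`).
The pair `(0, L ι)` gives the structure `a : L A ≅ A`, with inverse `ι ≫ v ≫ L r` (`fibreStr`); the
identity for `v ≫ L v` yields `L a = ν`, and `trivialization_lift` shows that the trivialization is
linear. This gives essential surjectivity.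

Full faithfulness rests on the section `⟨0, 1⟩ : A ⟶ X ⊗ A`. The fibre component of a linear
morphism `h` is determined by its restriction along this section, which is automatically an algebra
morphism (`exists_algebra_hom`). -/

/-- The terminal object is a zero object, so the units of monoids are zero morphisms. -/
theorem unit_hom_eq_zero {M : C} (f : 𝟙_ C ⟶ M) : f = 0 := by
  rw [← Category.id_comp f, toUnit_unique (𝟙 (𝟙_ C)) 0, zero_comp]

theorem hom_one_eq_zero {Y M : C} [MonObj M] : (1 : Y ⟶ M) = 0 := by
  rw [Hom.one_def, unit_hom_eq_zero η, comp_zero]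

/-- The zero morphism splits the projection `X ⊗ A ⟶ A`, so restriction along `⟨0, 1⟩` recovers the
second factor. This is the source of faithfulness. -/
theorem tensorHom_right_cancel {X X' A A' : C} {g g' : X ⟶ X'}
    {f f' : A ⟶ A'} (h : g ⊗ₘ f = g' ⊗ₘ f') : f = f' := by
  simpa using lift (0 : A ⟶ X) (𝟙 _) ≫= h =≫ snd _ _

end ZeroMorphisms

/-- A linear bundle morphism over `X` with invertible total component is an isomorphism. -/
def LinearMorphismOver.isoMk {C : Type u} [Category.{v} C] {𝕋 : TangentStructure C} {X : C}
    {B B' : DifferentialBundle 𝕋 X} (e : B.total ≅ B'.total) (comm : e.hom ≫ B'.proj = B.proj)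
    (lift : B.lift ≫ 𝕋.T.map e.hom = e.hom ≫ B'.lift) : B ≅ B' where
  hom := ⟨e.hom, comm, lift⟩
  inv := ⟨e.inv, (Iso.inv_comp_eq _).2 comm.symm, by
    rw [Iso.eq_inv_comp, ← Category.assoc, ← lift, Category.assoc, ← Functor.map_comp,
      Iso.hom_inv_id, CategoryTheory.Functor.map_id, Category.comp_id]⟩
  hom_inv_id := LinearMorphismOver.ext e.hom_inv_id
  inv_hom_id := LinearMorphismOver.ext e.inv_hom_id

/-- A linear bundle morphism over `X`, as a linear bundle morphism with base component `𝟙 X`. -/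
def LinearMorphismOver.toLinearMorphism {C : Type u} [Category.{v} C] {𝕋 : TangentStructure C}
    {X : C} {B B' : DifferentialBundle 𝕋 X} (φ : B ⟶ B') :
    (⟨X, B⟩ : DBun 𝕋) ⟶ ⟨X, B'⟩ :=
  { total := φ.hom
    base := 𝟙 X
    comm := φ.comm.trans (Category.comp_id _).symm
    lift := φ.lift }

namespace LinearAssignment

variable {C : Type u} [Category.{v} C] [CartesianMonoidalCategory C] [BraidedCategory C]
  {𝓛 : LinearAssignment C}

/-- The zero morphism factors through the terminal object, which `L` preserves. -/
theorem L_map_zero [HasZeroMorphisms C] {Y M : C} : 𝓛.L.map (0 : Y ⟶ M) = 1 := by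
  have h : (0 : Y ⟶ M) = (0 : Y ⟶ 𝟙_ C) ≫ (0 : 𝟙_ C ⟶ M) := zero_comp.symm
  rw [h, Functor.map_comp, 𝓛.L_unit_ext (𝓛.L.map (0 : Y ⟶ 𝟙_ C)) 1, MonObj.one_comp]

/-! ### The vertical part of the lift and the universal property of the total space -/

section Bundle

variable {X : C} (B : DifferentialBundle 𝓛.tangentStructure X)

/-- The lift of a differential bundle, as a morphism into `E ⊗ L E`. -/
def tangentLift : B.total ⟶ B.total ⊗ 𝓛.L.obj B.total := B.lift

/-- The second component `E ⟶ L E` of the lift `E ⟶ E ⊗ L E` of a differential bundle. -/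
def vert : B.total ⟶ 𝓛.L.obj B.total := tangentLift B ≫ snd _ _

/-- Additivity of the lift over `zero` fixes its first component, leaving `vert` as the only datum.
-/
theorem tangentLift_eq : tangentLift B = lift (B.proj ≫ B.zero) (vert B) := by
  have h : tangentLift B ≫ fst _ _ = B.proj ≫ B.zero := B.lift_isHom_tangent.comm
  ext
  · rw [h, lift_fst]
  · rw [lift_snd, vert]

theorem vert_map_proj : vert B ≫ 𝓛.L.map B.proj = 1 := by
  have h : tangentLift B ≫ (B.proj ⊗ₘ 𝓛.L.map B.proj) = B.proj ≫ lift (𝟙 X) (toUnit X ≫ η) :=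
    B.lift_isHom_map.comm
  rw [tangentLift_eq] at h
  simpa [← Hom.one_def, MonObj.comp_one] using h =≫ snd _ _

theorem zero_vert : B.zero ≫ vert B = 1 := by
  have h : B.zero ≫ tangentLift B = B.zero ≫ lift (𝟙 B.total) (toUnit B.total ≫ η) :=
    B.lift_isHom_tangent.map_zero
  rw [tangentLift_eq] at h
  simpa [← Hom.one_def, MonObj.comp_one] using h =≫ snd _ _

/-- This is the `L (L E)` component of the compatibility of the lift with `ℓ`; it later becomes the
algebra law `L a = ν` on the fibre. -/
theorem vert_map_vert : vert B ≫ 𝓛.L.map (vert B) = vert B ≫ (𝓛.ν B.total).inv := by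
  have h : tangentLift B ≫ (tangentLift B ⊗ₘ 𝓛.L.map (tangentLift B)) =
      tangentLift B ≫ 𝓛.prodLift B.total (𝓛.L.obj B.total) (𝓛.ν B.total) := B.lift_lift
  rw [tangentLift_eq, prodLift_eq] at h
  have h' := h =≫ (snd _ _ ≫ 𝓛.L.map (snd _ _))
  simpa [← Functor.map_comp] using h'

/-- The two tangent vectors added are `(q ζ ρ₁, v ρ₁)` and `(ρ₂, 0)`, in applicative notation. In
each component one summand is a zero of the bundle, so the unit laws leave `(ρ₂, v ρ₁)`. -/
theorem lift_add_eq (h) :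
    ((𝓛.tangentStructure.mapBundle B.toAdditiveBundle B.preserves).pairing
      (B.fst ≫ B.lift) (B.snd ≫ 𝓛.tangentStructure.z B.total) h ≫
        𝓛.tangentStructure.T.map B.add) = lift B.snd (B.fst ≫ vert B) := by
  have hp := B.isAdditive.zero_proj
  have hw := B.isAdditive.isPullback.w
  have h₁ : (B.proj ≫ B.zero) ≫ B.proj = 𝟙 B.total ≫ B.proj := by simp [hp]
  -- The pairing is written through `⟨q ≫ ζ, 1⟩` and the image under `L` of `⟨1, q ≫ ζ⟩`, so that
  -- composing with the sum meets exactly the two unit laws.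
  let k : B.pair ⟶ B.pair ⊗ 𝓛.L.obj B.pair :=
    lift (B.snd ≫ B.pairing _ _ h₁) (B.fst ≫ vert B ≫ 𝓛.L.map (B.pairing _ _ h₁.symm))
  have hk : (𝓛.tangentStructure.mapBundle B.toAdditiveBundle B.preserves).pairing
      (B.fst ≫ B.lift) (B.snd ≫ 𝓛.tangentStructure.z B.total) h = k := by
    apply AdditiveBundle.pair_hom_ext
    · rw [AdditiveBundle.pairing_fst]
      change B.fst ≫ tangentLift B = k ≫ (B.fst ⊗ₘ 𝓛.L.map B.fst)
      rw [tangentLift_eq]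
      ext <;> simp [k, ← Functor.map_comp, reassoc_of% hw]
    · rw [AdditiveBundle.pairing_snd]
      change B.snd ≫ lift (𝟙 _) (toUnit _ ≫ η) = k ≫ (B.snd ⊗ₘ 𝓛.L.map B.snd)
      ext
      · simp [k]
      · simp only [k, comp_lift, lift_snd, lift_map, Category.assoc, ← Functor.map_comp,
          AdditiveBundle.pairing_snd]
        -- `v ≫ L (q ≫ ζ)` is trivial because `v ≫ L q` is.
        rw [Functor.map_comp, ← Category.assoc (vert B), vert_map_proj]
        simp [← Hom.one_def, MonObj.comp_one, MonObj.one_comp]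
  rw [hk]
  change k ≫ (B.add ⊗ₘ 𝓛.L.map B.add) = _
  have hz : B.pairing _ _ h₁ ≫ B.add = 𝟙 _ := B.isAdditive.zero_add
  have hz' : B.pairing _ _ h₁.symm ≫ B.add = 𝟙 _ := B.isAdditive.add_zero
  ext <;> simp [k, hz, hz', ← Functor.map_comp]

theorem lift_isPullback : IsPullback (lift B.snd (B.fst ≫ vert B)) (B.fst ≫ B.proj)
    (B.proj ⊗ₘ 𝓛.L.map B.proj) (lift (𝟙 X) (toUnit X ≫ η[𝓛.L.obj X])) := by
  -- At `m = 0` the functor `iter` is the identity.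
  have h := B.lift_universal 0
  rw [lift_add_eq] at h
  exact h

/-- The comparison `⟨ρ₂, ρ₁ ≫ v⟩` sees only the vertical part of the first entry, so it cannot
separate the pairs `⟨e, e'⟩` and `⟨e', e'⟩`. The pullback property forces these to coincide. -/
theorem hom_ext_vert {Y : C} {e e' : Y ⟶ B.total} (h₁ : e ≫ B.proj = e' ≫ B.proj)
    (h₂ : e ≫ vert B = e' ≫ vert B) : e = e' := by
  have h : B.pairing e e' h₁ = B.pairing e' e' rfl := by
    apply (lift_isPullback B).hom_ext
    · ext <;> simp [reassoc_of% B.pairing_fst, h₂]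
    · simp [reassoc_of% B.pairing_fst, h₁]
  simpa using h =≫ B.fst

/-- The zero section supplies a point over `x`; the pullback then applies to `⟨x ≫ ζ, w⟩`, and the
first entry of the resulting pair is the required morphism. -/
theorem exists_lift_vert {Y : C} (x : Y ⟶ X) (w : Y ⟶ 𝓛.L.obj B.total)
    (hw : w ≫ 𝓛.L.map B.proj = 1) :
    ∃ e : Y ⟶ B.total, e ≫ B.proj = x ∧ e ≫ vert B = w := by
  have h : lift (x ≫ B.zero) w ≫ (B.proj ⊗ₘ 𝓛.L.map B.proj) =
      x ≫ lift (𝟙 X) (toUnit X ≫ η[𝓛.L.obj X]) := by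
    ext <;> simp [hw, B.isAdditive.zero_proj, Hom.one_def]
  refine ⟨(lift_isPullback B).lift _ _ h ≫ B.fst, ?_, ?_⟩
  · simp
  · simpa using (lift_isPullback B).lift_fst _ _ h =≫ snd _ _

/-! ### The fibre over the zero point: trivialization and algebra structure -/

section Kernel

variable [HasZeroMorphisms C] [HasKernels C]

/-- Keeping the vertical part and replacing the base point by `0` moves every point into the zero
fibre. -/
theorem exists_fibre_retraction : ∃ r : B.total ⟶ kernel B.proj,
    r ≫ kernel.ι B.proj ≫ vert B = vert B := by
  obtain ⟨e, h₁, h₂⟩ := exists_lift_vert B 0 (vert B) (vert_map_proj B)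
  exact ⟨kernel.lift _ e h₁, by simp [h₂]⟩

/-- The retraction of the total space onto the fibre over the zero point of the base. -/
noncomputable def fibreRetraction : B.total ⟶ kernel B.proj := (exists_fibre_retraction B).choose

@[simp]
theorem fibreRetraction_vert :
    fibreRetraction B ≫ kernel.ι B.proj ≫ vert B = vert B :=
  (exists_fibre_retraction B).choose_spec

theorem fibreRetraction_vert_assoc {Y : C} (g : 𝓛.L.obj B.total ⟶ Y) :
    fibreRetraction B ≫ kernel.ι B.proj ≫ vert B ≫ g = vert B ≫ g := by
  rw [← Category.assoc (kernel.ι _), ← Category.assoc, fibreRetraction_vert]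

@[simp]
theorem ι_fibreRetraction : kernel.ι B.proj ≫ fibreRetraction B = 𝟙 _ := by
  rw [← cancel_mono (kernel.ι B.proj)]
  apply hom_ext_vert <;> simp

/-- Conversely, the vertical part of a point of the zero fibre can be placed over any base point. -/
theorem exists_trivialization_inv : ∃ e : X ⊗ kernel B.proj ⟶ B.total,
    e ≫ B.proj = fst _ _ ∧ e ≫ vert B = snd _ _ ≫ kernel.ι B.proj ≫ vert B :=
  exists_lift_vert B _ _ (by simp [vert_map_proj, MonObj.comp_one])

/-- The isomorphism of the total space with the product of the base and the fibre. -/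
noncomputable def trivialization : B.total ≅ X ⊗ kernel B.proj where
  hom := lift B.proj (fibreRetraction B)
  inv := (exists_trivialization_inv B).choose
  hom_inv_id := by
    obtain ⟨h₁, h₂⟩ := (exists_trivialization_inv B).choose_spec
    apply hom_ext_vert
    · simp [h₁]
    · simp [h₂]
  inv_hom_id := by
    obtain ⟨h₁, h₂⟩ := (exists_trivialization_inv B).choose_spec
    apply CartesianMonoidalCategory.hom_ext
    · simp [h₁]
    · refine (cancel_mono (kernel.ι B.proj)).1 ?_
      apply hom_ext_vert
      · simp
      · simp [h₂]

/-- `L` preserves the product decomposition given by `trivialization`. -/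
theorem L_total_hom_ext {Y : C} {w w' : Y ⟶ 𝓛.L.obj B.total}
    (h₁ : w ≫ 𝓛.L.map B.proj = w' ≫ 𝓛.L.map B.proj)
    (h₂ : w ≫ 𝓛.L.map (fibreRetraction B) = w' ≫ 𝓛.L.map (fibreRetraction B)) : w = w' := by
  rw [← cancel_mono (𝓛.L.map (trivialization B).hom)]
  apply map_prod_hom_ext 𝓛.L <;>
    simpa only [Category.assoc, ← Functor.map_comp, trivialization, lift_fst, lift_snd]

theorem map_ι_map_proj : 𝓛.L.map (kernel.ι B.proj) ≫ 𝓛.L.map B.proj = 1 := by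
  rw [← Functor.map_comp, kernel.condition, L_map_zero]

/-- In the decomposition `L E ≅ L X ⊗ L A` the morphism `v` has trivial base component, so
projecting to `L A` and including back loses nothing. -/
theorem vert_map_fibreRetraction_ι :
    vert B ≫ 𝓛.L.map (fibreRetraction B) ≫ 𝓛.L.map (kernel.ι B.proj) = vert B := by
  apply L_total_hom_ext
  · simp [map_ι_map_proj, MonObj.comp_one, vert_map_proj]
  · simp [← Functor.map_comp]

/-- Since `L ι` is killed by `L q`, it is the vertical part of a unique morphism with base point
`0`; that morphism lands in the fibre. -/
theorem exists_fibre_str : ∃ a : 𝓛.L.obj (kernel B.proj) ⟶ kernel B.proj,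
    a ≫ kernel.ι B.proj ≫ vert B = 𝓛.L.map (kernel.ι B.proj) := by
  obtain ⟨e, h₁, h₂⟩ := exists_lift_vert B 0 _ (map_ι_map_proj B)
  exact ⟨kernel.lift _ e h₁, by simp [h₂]⟩

/-- The isomorphism `L A ≅ A`, for `A` the fibre of a differential bundle over the zero point. -/
noncomputable def fibreStr : 𝓛.L.obj (kernel B.proj) ≅ kernel B.proj where
  hom := (exists_fibre_str B).choose
  inv := kernel.ι B.proj ≫ vert B ≫ 𝓛.L.map (fibreRetraction B)
  hom_inv_id := by
    rw [reassoc_of% (exists_fibre_str B).choose_spec,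
      ← Functor.map_comp, ι_fibreRetraction, CategoryTheory.Functor.map_id]
  inv_hom_id := by
    refine (cancel_mono (kernel.ι B.proj)).1 ?_
    apply hom_ext_vert
    · simp
    · simp [(exists_fibre_str B).choose_spec, vert_map_fibreRetraction_ι]

theorem fibreStr_inv : (fibreStr B).inv =
    kernel.ι B.proj ≫ vert B ≫ 𝓛.L.map (fibreRetraction B) := rfl

/-- After precomposing with `a⁻¹ = ι ≫ v ≫ L r`, the inner `L r ≫ L ι` is absorbed by `v`. What
remains is `v ≫ L v = v ≫ ν⁻¹` together with the naturality of `ν`. -/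
theorem map_fibreStr_inv : 𝓛.L.map (fibreStr B).inv = (𝓛.ν (kernel B.proj)).inv := by
  have hν : 𝓛.L.map (fibreRetraction B) ≫ (𝓛.ν (kernel B.proj)).inv =
      (𝓛.ν B.total).inv ≫ 𝓛.L.map (𝓛.L.map (fibreRetraction B)) := by
    rw [Iso.comp_inv_eq, Category.assoc, 𝓛.ν_naturality, Iso.inv_hom_id_assoc]
  rw [← cancel_epi (fibreStr B).inv, fibreStr_inv]
  simp only [Functor.map_comp, Category.assoc]
  rw [hν, ← reassoc_of% vert_map_vert B, reassoc_of% vert_map_fibreRetraction_ι B]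

/-- The linear algebra structure on the fibre of a differential bundle over the zero point. -/
noncomputable def fibreAlgebra : 𝓛.Algebra where
  obj := kernel B.proj
  str := fibreStr B
  map_str := by
    rw [← cancel_mono (𝓛.ν _).inv, Iso.hom_inv_id, ← map_fibreStr_inv, ← Functor.map_comp,
      Iso.hom_inv_id, CategoryTheory.Functor.map_id]

/-- Zero vectors have trivial vertical part, hence trivial fibre coordinate. -/
theorem zero_fibreRetraction : B.zero ≫ fibreRetraction B = 0 := by
  refine (cancel_mono (kernel.ι B.proj)).1 ?_
  apply hom_ext_vert
  · simp
  · simp [zero_vert, hom_one_eq_zero]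

/-- The four components to compare amount to `q ζ q = q`, `q ζ r = 0`, `v (L q) = 0` and `v (L r) =
r a⁻¹`, in diagrammatic order; the last combines the formula for `a⁻¹` with `r ι v = v`. -/
theorem trivialization_lift : B.lift ≫ 𝓛.tangentStructure.T.map (trivialization B).hom =
    (trivialization B).hom ≫ 𝓛.prodLift X (fibreAlgebra B).obj (fibreAlgebra B).str := by
  -- The monoid structure transported along `a` is attached to `(fibreAlgebra B).obj`; here it is
  -- made available on the kernel itself.
  let : MonObj (kernel B.proj) := (inferInstance : MonObj (fibreAlgebra B).obj)
  change tangentLift B ≫ (lift B.proj (fibreRetraction B) ⊗ₘ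
      𝓛.L.map (lift B.proj (fibreRetraction B))) =
    lift B.proj (fibreRetraction B) ≫ 𝓛.prodLift X (kernel B.proj) (fibreStr B)
  rw [tangentLift_eq, prodLift_eq]
  apply 𝓛.T_ext
  · simp [B.isAdditive.zero_proj]
  · simp [zero_fibreRetraction, hom_one_eq_zero]
  · simp [← Functor.map_comp, vert_map_proj, MonObj.comp_one]
  · simp [← Functor.map_comp]
    rw [fibreStr_inv, fibreRetraction_vert_assoc]

/-- Every differential bundle is isomorphic over its base to a product with a linear algebra. -/
noncomputable def isoProd : B ≅ 𝓛.prodDifferentialBundle X (fibreAlgebra B) :=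
  LinearMorphismOver.isoMk (B' := 𝓛.prodDifferentialBundle X (fibreAlgebra B))
    (trivialization B) (lift_fst _ _) (trivialization_lift B)

end Kernel
end Bundle

/-! ### Linear morphisms between product bundles: fullness and faithfulness -/

section FullyFaithful

/-- Linear bundle morphisms between products with linear algebras are products. -/
theorem exists_algebra_hom [HasZeroMorphisms C] {X X' : C} {A A' : 𝓛.Algebra}
    (h : X ⊗ A.obj ⟶ X' ⊗ A'.obj) (g : X ⟶ X') (hg : h ≫ fst _ _ = fst _ _ ≫ g)
    (hl : 𝓛.prodLift X A.obj A.str ≫ (h ⊗ₘ 𝓛.L.map h) =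
      h ≫ 𝓛.prodLift X' A'.obj A'.str) :
    ∃ f : A ⟶ A', h = g ⊗ₘ f.hom := by
  -- The fibre component of `h` on the zero fibre.
  let f : A.obj ⟶ A'.obj := lift 0 (𝟙 _) ≫ h ≫ snd _ _
  have hf : h ≫ snd _ _ = snd _ _ ≫ A.str.inv ≫ 𝓛.L.map f ≫ A'.str.hom := by
    rw [← cancel_mono A'.str.inv]
    -- The `L A'` component of linearity. Its source side only involves vectors `(0, a⁻¹ ·)`, so `h`
    -- enters through `L` of its restriction `f`, and the dependence on `X` disappears.
    have := hl =≫ (snd _ _ ≫ 𝓛.L.map (snd _ _))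
    simp only [prodLift_eq, Category.assoc, tensorHom_snd_assoc, lift_snd_assoc,
      mapLift_snd] at this
    simp only [Category.assoc, Iso.hom_inv_id, Category.comp_id, ← this, f, Functor.map_comp]
    simp only [← Category.assoc]
    congr 2
    -- What remains identifies the vector with components `0` and `snd ≫ a⁻¹` with the image of `snd
    -- ≫ a⁻¹` under `L ⟨0, 1⟩`.
    apply map_prod_hom_ext 𝓛.L
    · simp [← Functor.map_comp, L_map_zero, MonObj.comp_one]
    · simp [← Functor.map_comp]
  refine ⟨⟨f, ?_⟩, ?_⟩
  · rw [← Iso.inv_comp_eq]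
    -- Restricting `hf` to the zero fibre gives `f = a⁻¹ ≫ L f ≫ a'`, which is the algebra morphism
    -- law.
    have := lift (0 : A.obj ⟶ X) (𝟙 _) ≫= hf
    simpa using this.symm
  · apply CartesianMonoidalCategory.hom_ext
    · rw [hg, tensorHom_fst]
    · have := lift (0 : A.obj ⟶ X) (𝟙 _) ≫= hf
      rw [lift_snd_assoc, Category.id_comp] at this
      exact hf.trans ((congrArg _ this.symm).trans (tensorHom_snd _ _).symm)

variable (𝓛) [HasZeroMorphisms C]

theorem toDBunOver_full (X : C) : (𝓛.toDBunOver X).Full where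
  map_surjective {A A'} φ := by
    obtain ⟨f, hf⟩ := exists_algebra_hom (A := A) (A' := A') φ.hom (𝟙 X)
      (φ.comm.trans (Category.comp_id _).symm) φ.lift
    exact ⟨f, LinearMorphismOver.ext hf.symm⟩

theorem toDBunOver_faithful (X : C) : (𝓛.toDBunOver X).Faithful where
  map_injective h := Algebra.Hom.ext
    (tensorHom_right_cancel (congrArg LinearMorphismOver.hom h))

theorem toDBun_full : 𝓛.toDBun.Full where
  map_surjective {P Q} φ := by
    obtain ⟨f, hf⟩ := exists_algebra_hom (A := P.2) (A' := Q.2) φ.total φ.base φ.comm φ.lift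
    exact ⟨⟨φ.base, f⟩, LinearMorphism.ext hf.symm rfl⟩

theorem toDBun_faithful : 𝓛.toDBun.Faithful where
  map_injective h := Prod.ext (congrArg LinearMorphism.base h) (Algebra.Hom.ext
    (tensorHom_right_cancel (congrArg LinearMorphism.total h)))

/-! ### Essential surjectivity and the two equivalences -/

variable [HasKernels C]

theorem toDBunOver_essSurj (X : C) : (𝓛.toDBunOver X).EssSurj where
  mem_essImage B := ⟨fibreAlgebra B, ⟨(isoProd B).symm⟩⟩

theorem toDBun_essSurj : 𝓛.toDBun.EssSurj where
  mem_essImage B := ⟨(B.base, fibreAlgebra B.bundle), ⟨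
    { hom := LinearMorphismOver.toLinearMorphism (isoProd B.bundle).inv
      inv := LinearMorphismOver.toLinearMorphism (isoProd B.bundle).hom
      hom_inv_id := LinearMorphism.ext
        (congrArg LinearMorphismOver.hom (isoProd B.bundle).inv_hom_id) (Category.id_comp _)
      inv_hom_id := LinearMorphism.ext
        (congrArg LinearMorphismOver.hom (isoProd B.bundle).hom_inv_id) (Category.id_comp _) }⟩⟩

theorem toDBun_isEquivalence : 𝓛.toDBun.IsEquivalence where
  faithful := 𝓛.toDBun_faithful
  full := 𝓛.toDBun_full
  essSurj := 𝓛.toDBun_essSurj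

theorem toDBunOver_isEquivalence (X : C) : (𝓛.toDBunOver X).IsEquivalence where
  faithful := 𝓛.toDBunOver_faithful X
  full := 𝓛.toDBunOver_full X
  essSurj := 𝓛.toDBunOver_essSurj X

end FullyFaithful

end LinearAssignment
end TangentCat

/-! ### The theorem for linear and additive assignments -/

open TangentCat
theorem mainTheorem5 {C : Type u} [Category.{v} C] [CartesianMonoidalCategory C]
    [BraidedCategory C] [HasZeroMorphisms C] [HasKernels C] :
    (∀ 𝓛 : LinearAssignment C,
      (𝓛.toDBun : C × 𝓛.Algebra ⥤ DBun 𝓛.tangentStructure).IsEquivalence ∧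
      (∀ X : C, (𝓛.toDBunOver X :
        𝓛.Algebra ⥤ DifferentialBundle 𝓛.tangentStructure X).IsEquivalence) ∧
      (∀ (X : C) (B : DifferentialBundle 𝓛.tangentStructure X),
        ∃ A : 𝓛.Algebra, Nonempty (B ≅ 𝓛.prodDifferentialBundle X A))) ∧
    (∀ 𝓛 : AdditiveAssignment C,
      (𝓛.toDBun : C × 𝓛.Algebra ⥤
        DBun 𝓛.rosickyTangentStructure.toTangentStructure).IsEquivalence ∧
      (∀ X : C, (𝓛.toDBunOver X : 𝓛.Algebra ⥤
        DifferentialBundle 𝓛.rosickyTangentStructure.toTangentStructure X).IsEquivalence) ∧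
      (∀ (X : C) (B : DifferentialBundle 𝓛.rosickyTangentStructure.toTangentStructure X),
        ∃ A : 𝓛.Algebra, Nonempty (B ≅ 𝓛.prodDifferentialBundle X A))) :=
  ⟨fun 𝓛 => ⟨𝓛.toDBun_isEquivalence, 𝓛.toDBunOver_isEquivalence,
    fun _ B => ⟨_, ⟨LinearAssignment.isoProd B⟩⟩⟩,
  -- Differential bundles and linear morphisms do not refer to negatives, and the Rosický structure
  -- extends the tangent structure of the underlying linear assignment, so the linear case applies
  -- verbatim.
  fun 𝓛 => ⟨𝓛.toDBun_isEquivalence, 𝓛.toDBunOver_isEquivalence,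
    fun _ B => ⟨_, ⟨LinearAssignment.isoProd B⟩⟩⟩⟩
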